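/- Let $X$ be a (real or complex) Banach space and let $A(r)$, $B(r)$, $r\in\mathbb R$, be linear operators in $X$ with domains $D(A(r))$, $D(B(r))$; the sum $A(r)+B(r)$ has domain $D(A(r))\cap D(B(r))$. *Notions.* A classical solution of $u'(t)=C(t)u(t)$ $(t\ge s)$, $u(s)=x$, is a function $u\in C^1([s,\infty);X)$ with $u(s)=x$, $u(t)\in D(C(t))$ and $u'(t)=C(t)u(t)$ for all $t\ge s$. The non-autonomous Cauchy problem for $C(\cdot)$ is *well-posed* if (i) for every $s$ the set $Y_s$ of all $y$ for which a classical solution $u_s(\cdot,y)$ with $u_s(s,y)=y$ exists is dense in $X$; (ii) these solutions are unique; (iii) if $s_n\to s$, $Y_{s_n}\ni y_n\to y\in Y_s$, then $\hat u_{s_n}(t,y_n)\to\hat u_s(t,y)$ uniformly for $t$ in compact subsets of $\mathbb R$, where $\hat u_r(t,y)=u_r(t,y)$ for $t\ge r$ and $\hat u_r(t,y)=y$ for $t<r$; (iv) there are $M'\ge1$, $\omega'\in\mathbb R$ with $\|u_s(t,y)\|\le M'e^{\omega'(t-s)}\|y\|$ for all $s\in\mathbb R$, $y\in Y_s$, $t\ge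 s$. An *evolution family* is a family $(W(t,s))_{t\ge s}$ of bounded operators with $W(t,r)W(r,s)=W(t,s)$ for $t\ge r\ge s$, $W(t,t)=I$, $(t,s)\mapsto W(t,s)$ strongly continuous, and $\|W(t,s)\|\le M''e^{\omega''(t-s)}$ for some $M''\ge1$, $\omega''\in\mathbb R$. It *solves* the Cauchy problem for $C(\cdot)$ if for every $s$ the set of $y$ for which $t\mapsto W(t,s)y$ is a classical solution on $[s,\infty)$ with initial value $y$ at time $s$ is dense. Its *evolution semigroup* on $C_0(\mathbb R;X)$ is $(\mathcal W(t)f)(s)=W(s,s-t)f(s-t)$, $t\ge0$. *Assumptions.* Let $M\ge1$ and $\omega\in\mathbb R$. (a) The non-autonomous Cauchy problem for $A(\cdot)+B(\cdot)$ is well-posed, $W$ is an evolution family solving it, and the evolution semigroup $\mathcal W$ of $W$ is generated by the closure of the (closable) operator $\mathcal C=-\frac{d}{ds}+A(\cdot)+B(\cdot)$ on $C_0(\mathbb R;X)$. Here $\mathcal C$ acts by $(\mathcal Cf)(s)=-f'(s)+A(s)f(s)+B(s)f(s)$, and its domain consists of all $f\in C^1(\mathbb R;X)$ such that $f,f'\in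 C_0(\mathbb R;X)$, $f(s)\in D(A(s))\cap D(B(s))$ for all $s$, and both $s\mapsto A(s)f(s)$ and $s\mapsto B(s)f(s)$ belong to $C_0(\mathbb R;X)$. (b) For every $r\in\mathbb R$, $A(r)$ and $B(r)$ generate $C_0$-semigroups with $\|e^{tA(r)}\|\le Me^{\omega t}$ and $\|e^{tB(r)}\|\le Me^{\omega t}$ for all $t\ge0$, and for all $t\ge0$ and $n\ge1$ $$\sup_{s\in\mathbb R}\Bigl\|U_1U_2\cdots U_n\Bigr\|\le Me^{\omega t},\qquad U_p=e^{\frac tnB(s-\frac{pt}n)}e^{\frac tnA(s-\frac{pt}n)}.$$ (c) For all $\lambda>\omega$ and $x\in X$ the maps $r\mapsto R(\lambda,A(r))x$ and $r\mapsto R(\lambda,B(r))x$ are continuous on $\mathbb R$, where $R(\lambda,A(r))=(\lambda-A(r))^{-1}$. *Conclusion.* For every $x\in X$ $$W(t,s)x=\lim_{n\to\infty}\prod_{p=0}^{n-1}\Bigl(e^{\frac{t-s}{n}B(s+\frac{p(t-s)}{n})}e^{\frac{t-s}{n}A(s+\frac{p(t-s)}{n})}\Bigr)x ,$$ locally uniformly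 in $(t,s)$ with $s\le t$, where $\prod_{p=0}^{n-1}V_p:=V_{n-1}\cdots V_1V_0$. -/

import Mathlib

open Filter Topology Set
open scoped ZeroAtInfty

namespace NonautonomousSplitting

section Semigroups

variable {𝕜 E : Type*} [RCLike 𝕜] [NormedAddCommGroup E] [NormedSpace 𝕜 E] [NormedSpace ℝ E]

/-- The unbounded operator `A` is the infinitesimal generator of the family `T = (T t)_{t ≥ 0}`:
`x ∈ D(A)` and `A x = y` if and only if `(T h x - x) / h → y` as `h ↓ 0`. -/
def IsGenerator (A : E →ₗ.[𝕜] E) (T : ℝ → E →L[𝕜] E) : Prop :=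
  ∀ x y : E, (x, y) ∈ A.graph ↔ Tendsto (fun h : ℝ => h⁻¹ • (T h x - x)) (𝓝[>] 0) (𝓝 y)

/-- `T` is a `C₀`-semigroup with generator `A`, that is, `T t = e^{tA}` for `t ≥ 0`
(the values of `T` at negative times are irrelevant). -/
structure GeneratesC0Semigroup (A : E →ₗ.[𝕜] E) (T : ℝ → E →L[𝕜] E) : Prop where
  map_zero : T 0 = 1
  map_add : ∀ s t : ℝ, 0 ≤ s → 0 ≤ t → T (s + t) = T s * T t
  continuousOn : ∀ x : E, ContinuousOn (fun t => T t x) (Ici 0)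
  isGenerator : IsGenerator A T

/-- The semigroup `T` is of type `(M, ω)`. -/
def IsOfType (T : ℝ → E →L[𝕜] E) (M ω : ℝ) : Prop :=
  ∀ t : ℝ, 0 ≤ t → ‖T t‖ ≤ M * Real.exp (ω * t)

end Semigroups

section Resolvents

variable {𝕜 E : Type*} [RCLike 𝕜] [NormedAddCommGroup E] [NormedSpace 𝕜 E]

/-- The bounded operator `R` is a two-sided inverse of `μ - A : D(A) → E`. -/
def IsResolventAt (A : E →ₗ.[𝕜] E) (μ : 𝕜) (R : E →L[𝕜] E) : Prop :=
  (∀ x : E, (R x, μ • R x - x) ∈ A.graph) ∧ ∀ x : A.domain, R (μ • (x : E) - A x) = x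

open Classical in
/-- The resolvent `R(μ, A) = (μ - A)⁻¹` for `μ` in the resolvent set of `A` (and `0` otherwise). -/
noncomputable def resolventOp (A : E →ₗ.[𝕜] E) (μ : 𝕜) : E →L[𝕜] E :=
  if h : ∃ R : E →L[𝕜] E, IsResolventAt A μ R then h.choose else 0

end Resolvents

section CauchyProblem

variable {𝕜 X : Type*} [RCLike 𝕜] [NormedAddCommGroup X] [NormedSpace 𝕜 X] [NormedSpace ℝ X]

/-- `u` (restricted to `[s, ∞)`) is a classical solution of `u'(t) = A(t) u(t)` for `t ≥ s`,
`u(s) = x`: it is `C¹` on `[s, ∞)`, `u(t) ∈ D(A(t))` and `u'(t) = A(t) u(t)` for all `t ≥ s`. -/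
def IsClassicalSolution (A : ℝ → X →ₗ.[𝕜] X) (s : ℝ) (x : X) (u : ℝ → X) : Prop :=
  u s = x ∧ ∃ u' : ℝ → X, ContinuousOn u' (Ici s) ∧
    ∀ t ∈ Ici s, HasDerivWithinAt u (u' t) (Ici s) t ∧ (u t, u' t) ∈ (A t).graph

/-- The regularity subspace `Y_s`. -/
def regularitySet (A : ℝ → X →ₗ.[𝕜] X) (s : ℝ) : Set X :=
  {y | ∃ u : ℝ → X, IsClassicalSolution A s y u}

open Classical in
/-- Extension of a solution that starts at time `r` with value `y` by the constant `y` to times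
before `r`. -/
noncomputable def extendSolution (r : ℝ) (y : X) (u : ℝ → X) : ℝ → X :=
  fun t => if r ≤ t then u t else y

/-- Well-posedness (with exponentially bounded solutions) of the non-autonomous Cauchy problem. -/
structure WellPosed (A : ℝ → X →ₗ.[𝕜] X) : Prop where
  existence : ∀ s : ℝ, Dense (regularitySet A s)
  uniqueness : ∀ (s : ℝ) (y : X) (u v : ℝ → X),
    IsClassicalSolution A s y u → IsClassicalSolution A s y v → EqOn u v (Ici s)
  continuous_dependence : ∀ (s : ℝ) (y : X) (u : ℝ → X) (σ : ℕ → ℝ) (η : ℕ → X) (v : ℕ → ℝ → X),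
    IsClassicalSolution A s y u → (∀ n, IsClassicalSolution A (σ n) (η n) (v n)) →
    Tendsto σ atTop (𝓝 s) → Tendsto η atTop (𝓝 y) →
    ∀ K : Set ℝ, IsCompact K →
      TendstoUniformlyOn (fun n => extendSolution (σ n) (η n) (v n)) (extendSolution s y u) atTop K
  exponentially_bounded : ∃ M ω : ℝ, 1 ≤ M ∧ ∀ (s : ℝ) (y : X) (u : ℝ → X),
    IsClassicalSolution A s y u → ∀ t, s ≤ t → ‖u t‖ ≤ M * Real.exp (ω * (t - s)) * ‖y‖

end CauchyProblem

section EvolutionFamilies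

variable {𝕜 X : Type*} [RCLike 𝕜] [NormedAddCommGroup X] [NormedSpace 𝕜 X]

/-- `(W t s)_{t ≥ s}` is an exponentially bounded evolution family (the values `W t s` for `t < s`
are irrelevant). -/
structure IsEvolutionFamily (W : ℝ → ℝ → X →L[𝕜] X) : Prop where
  comp : ∀ t r s : ℝ, s ≤ r → r ≤ t → W t r * W r s = W t s
  refl : ∀ t : ℝ, W t t = 1
  continuousOn : ∀ x : X, ContinuousOn (fun p : ℝ × ℝ => W p.1 p.2 x) {p | p.2 ≤ p.1}
  bound : ∃ M ω : ℝ, 1 ≤ M ∧ ∀ t s : ℝ, s ≤ t → ‖W t s‖ ≤ M * Real.exp (ω * (t - s))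

/-- The evolution family `W` solves the Cauchy problem for `A`: for every `s`, the set of those `y`
for which `t ↦ W t s y` is a classical solution with initial value `y` at time `s` is dense. -/
def Solves [NormedSpace ℝ X] (W : ℝ → ℝ → X →L[𝕜] X) (A : ℝ → X →ₗ.[𝕜] X) : Prop :=
  ∀ s : ℝ, Dense {y : X | IsClassicalSolution A s y (fun t => W t s y)}

variable {W : ℝ → ℝ → X →L[𝕜] X}

theorem IsEvolutionFamily.continuous_shift (hW : IsEvolutionFamily W) {τ : ℝ} (hτ : 0 ≤ τ)
    (f : C₀(ℝ, X)) : Continuous fun s : ℝ => W s (s - τ) (f (s - τ)) := by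
  obtain ⟨M, ω, -, hb⟩ := hW.bound
  have hcont (x : X) : Continuous fun s : ℝ => W s (s - τ) x :=
    (hW.continuousOn x).comp_continuous (f := fun s : ℝ => (s, s - τ)) (by fun_prop)
      (fun s => by simpa using hτ)
  rw [continuous_iff_continuousAt]
  intro s₀
  have h1 : Tendsto (fun s => W s (s - τ) (f (s - τ) - f (s₀ - τ))) (𝓝 s₀) (𝓝 0) := by
    have hf : Tendsto (fun s => M * Real.exp (ω * τ) * ‖f (s - τ) - f (s₀ - τ)‖) (𝓝 s₀) (𝓝 0) := by
      have : Continuous fun s => M * Real.exp (ω * τ) * ‖f (s - τ) - f (s₀ - τ)‖ := by fun_prop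
      simpa using this.tendsto s₀
    refine squeeze_zero_norm (fun s => ?_) hf
    refine (ContinuousLinearMap.le_opNorm _ _).trans ?_
    gcongr
    simpa using hb s (s - τ) (by linarith)
  have h2 := h1.add ((hcont (f (s₀ - τ))).tendsto s₀)
  simpa [ContinuousAt] using h2

theorem IsEvolutionFamily.tendsto_shift (hW : IsEvolutionFamily W) {τ : ℝ} (hτ : 0 ≤ τ)
    (f : C₀(ℝ, X)) : Tendsto (fun s : ℝ => W s (s - τ) (f (s - τ))) (cocompact ℝ) (𝓝 0) := by
  obtain ⟨M, ω, -, hb⟩ := hW.bound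
  have hs : Tendsto (fun s : ℝ => s - τ) (cocompact ℝ) (cocompact ℝ) :=
    (Homeomorph.subRight τ).isClosedEmbedding.tendsto_cocompact
  have hf : Tendsto (fun s => M * Real.exp (ω * τ) * ‖f (s - τ)‖) (cocompact ℝ) (𝓝 0) := by
    simpa using ((f.zero_at_infty'.comp hs).norm.const_mul (M * Real.exp (ω * τ)))
  refine squeeze_zero_norm (fun s => ?_) hf
  refine (ContinuousLinearMap.le_opNorm _ _).trans ?_
  gcongr
  simpa using hb s (s - τ) (by linarith)

/-- The evolution semigroup of `W` on `C₀(ℝ, X)`: `(𝒲(t) f)(s) = W(s, s - t) f(s - t)` for `t ≥ 0`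
(a negative `t` is replaced by `0`). -/
noncomputable def evolutionSemigroup (W : ℝ → ℝ → X →L[𝕜] X) (hW : IsEvolutionFamily W) (t : ℝ) :
    C₀(ℝ, X) →L[𝕜] C₀(ℝ, X) :=
  LinearMap.mkContinuousOfExistsBound
    { toFun := fun f =>
        { toFun := fun s => W s (s - max t 0) (f (s - max t 0))
          continuous_toFun := hW.continuous_shift (le_max_right t 0) f
          zero_at_infty' := hW.tendsto_shift (le_max_right t 0) f }
      map_add' := fun f g => by ext s; simp
      map_smul' := fun c f => by ext s; simp }
    (by
      obtain ⟨M, ω, hM, hb⟩ := hW.bound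
      refine ⟨M * Real.exp (ω * max t 0), fun f => ?_⟩
      rw [← ZeroAtInftyContinuousMap.norm_toBCF_eq_norm]
      refine (BoundedContinuousFunction.norm_le (by positivity)).2 fun s => ?_
      refine (ContinuousLinearMap.le_opNorm _ _).trans ?_
      gcongr
      · simpa using hb s (s - max t 0) (by linarith [le_max_right t 0])
      · rw [← ZeroAtInftyContinuousMap.norm_toBCF_eq_norm]
        exact f.toBCF.norm_coe_le_norm _)

theorem evolutionSemigroup_apply (hW : IsEvolutionFamily W) {t : ℝ} (ht : 0 ≤ t) (f : C₀(ℝ, X))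
    (s : ℝ) : evolutionSemigroup W hW t f s = W s (s - t) (f (s - t)) := by
  change W s (s - max t 0) (f (s - max t 0)) = _
  rw [max_eq_left ht]

end EvolutionFamilies

section OperatorsOnFunctions

variable {𝕜 X : Type*} [RCLike 𝕜] [NormedAddCommGroup X] [NormedSpace 𝕜 X]

/-- Graph of the multiplication operator `A(·)` on `C₀(ℝ, X)`. -/
def multiplicationGraph (A : ℝ → X →ₗ.[𝕜] X) : Submodule 𝕜 (C₀(ℝ, X) × C₀(ℝ, X)) where
  carrier := {p | ∀ s : ℝ, (p.1 s, p.2 s) ∈ (A s).graph}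
  add_mem' := fun ha hb s => (A s).graph.add_mem (ha s) (hb s)
  zero_mem' := fun s => (A s).graph.zero_mem
  smul_mem' := fun c _ ha s => (A s).graph.smul_mem c (ha s)

/-- The multiplication operator `A(·)` on `C₀(ℝ, X)`, with domain the set of all `f` such that
`f(s) ∈ D(A(s))` for all `s` and `s ↦ A(s) f(s)` belongs to `C₀(ℝ, X)`. -/
noncomputable def multiplicationOp (A : ℝ → X →ₗ.[𝕜] X) : C₀(ℝ, X) →ₗ.[𝕜] C₀(ℝ, X) :=
  (multiplicationGraph A).toLinearPMap

theorem mem_graph_multiplicationOp (A : ℝ → X →ₗ.[𝕜] X) (f g : C₀(ℝ, X)) :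
    (f, g) ∈ (multiplicationOp A).graph ↔ ∀ s : ℝ, (f s, g s) ∈ (A s).graph := by
  rw [multiplicationOp, Submodule.toLinearPMap_graph_eq]
  · rfl
  · intro p hp h0
    ext s
    refine (A s).graph_fst_eq_zero_snd (hp s) ?_
    simp [h0]

variable [NormedSpace ℝ X]

/-- Graph of the differentiation operator on `C₀(ℝ, X)`. -/
def derivativeGraph (𝕜 X : Type*) [RCLike 𝕜] [NormedAddCommGroup X] [NormedSpace 𝕜 X]
    [NormedSpace ℝ X] : Submodule 𝕜 (C₀(ℝ, X) × C₀(ℝ, X)) where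
  carrier := {p | ∀ s : ℝ, HasDerivAt (fun r => p.1 r) (p.2 s) s}
  add_mem' := fun ha hb s => (ha s).add (hb s)
  zero_mem' := fun s => hasDerivAt_const s 0
  smul_mem' := fun c _ ha s => (ha s).const_smul c

/-- The differentiation operator `f ↦ f'` on `C₀(ℝ, X)`, with domain the set of all continuously
differentiable `f` such that `f` and `f'` belong to `C₀(ℝ, X)`. -/
noncomputable def derivativeOp (𝕜 X : Type*) [RCLike 𝕜] [NormedAddCommGroup X] [NormedSpace 𝕜 X]
    [NormedSpace ℝ X] : C₀(ℝ, X) →ₗ.[𝕜] C₀(ℝ, X) :=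
  (derivativeGraph 𝕜 X).toLinearPMap

theorem mem_graph_derivativeOp (f g : C₀(ℝ, X)) :
    (f, g) ∈ (derivativeOp 𝕜 X).graph ↔ ∀ s : ℝ, HasDerivAt (fun r => f r) (g s) s := by
  rw [derivativeOp, Submodule.toLinearPMap_graph_eq]
  · rfl
  · intro p hp h0
    ext s
    have h := hp s
    simp only [h0, ZeroAtInftyContinuousMap.coe_zero, Pi.zero_apply] at h
    exact h.unique (hasDerivAt_const s 0)

/-- The operator `𝒞 = -d/ds + A(·) + B(·)` on `C₀(ℝ, X)`, defined on the intersection of the domains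
of the three summands. -/
noncomputable def sumOp (A B : ℝ → X →ₗ.[𝕜] X) : C₀(ℝ, X) →ₗ.[𝕜] C₀(ℝ, X) :=
  -derivativeOp 𝕜 X + multiplicationOp A + multiplicationOp B

end OperatorsOnFunctions

section Products

variable {R : Type*} [Monoid R]

/-- The time-ordered product `∏_{p=0}^{n-1} U p = U (n-1) ⋯ U 1 U 0`. -/
def ascProd (U : ℕ → R) : ℕ → R
  | 0 => 1
  | n + 1 => U n * ascProd U n

/-- The product `∏_{p=n}^{1} U p = U 1 U 2 ⋯ U n`. -/
def descProd (U : ℕ → R) : ℕ → R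
  | 0 => 1
  | n + 1 => descProd U n * U (n + 1)

end Products

end NonautonomousSplitting

namespace NonautonomousSplitting

/-! The time dependence is removed by passing to functions of time. On functions `f : ℝ → X` put `(F
h f)(s) = e^{hB(s-h)} e^{hA(s-h)} f(s-h)`. The value of `F h ^ n f` at `s` is the splitting product
over the nodes `s-h, …, s-nh`, applied to `f(s-nh)`, so the assertion becomes the autonomous
statement `F h ^ n f → 𝒲(nh) f` in the sup norm, evaluated at a function that equals `x` near the
initial time.

That statement is Chernoff's product formula. Stability is the assumed bound on the products.
Consistency, `(F h f - f)/h → 𝒞 f` for `f` in the domain of `𝒞`, is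
`eventually_forall_splitting_sub_le`; its uniformity in `s` rests on the strong continuity of the
resolvents, which makes the semigroups strongly continuous at time zero uniformly along a `C₀`
function (`eventually_forall_semigroup_sub_le`). The domain of `𝒞` suffices because the generator of
`𝒲` is its closure.

The operators `F h` act on all bounded functions rather than on `C₀(ℝ, X)`, so it need not be
checked that they preserve continuity. Hence `chernoff` compares a scheme on a space `Z` with a
semigroup on another space `E` through a bounded map `J : E → Z`. Its proof uses the resolvents of
`(F h - 1)/h` to turn an exact orbit into an approximate orbit of the scheme, with local error
`o(h)`. -/

theorem IsOfType.exists_bound {𝕜 E : Type*} [RCLike 𝕜] [NormedAddCommGroup E]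
    [NormedSpace 𝕜 E] {T : ℝ → E →L[𝕜] E} {M ω : ℝ} (hT : IsOfType T M ω) (hM : 0 ≤ M) {b t : ℝ}
    (ht : 0 ≤ t) (htb : t ≤ b) : ‖T t‖ ≤ M * Real.exp (|ω| * b) := by
  refine (hT t ht).trans ?_
  gcongr
  exact le_abs_self ω

/-! ### Semigroups, their generators and resolvents. -/

section SemigroupLemmas

variable {𝕜 E : Type*} [RCLike 𝕜] [NormedAddCommGroup E] [NormedSpace 𝕜 E] [NormedSpace ℝ E]
  {A : E →ₗ.[𝕜] E} {T : ℝ → E →L[𝕜] E}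

theorem map_real_smul_clm (L : E →L[𝕜] E) (c : ℝ) (x : E) : L (c • x) = c • L x :=
  map_real_smul L L.continuous c x

namespace GeneratesC0Semigroup

theorem continuous_max (hT : GeneratesC0Semigroup A T) (x : E) :
    Continuous fun τ : ℝ => T (max τ 0) x :=
  (hT.continuousOn x).comp_continuous (by fun_prop) fun τ => le_max_right τ 0

theorem map_add_apply (hT : GeneratesC0Semigroup A T) {s t : ℝ} (hs : 0 ≤ s) (ht : 0 ≤ t) (x : E) :
    T (s + t) x = T s (T t x) := by
  rw [hT.map_add s t hs ht]; rfl

theorem comm_apply (hT : GeneratesC0Semigroup A T) {s t : ℝ} (hs : 0 ≤ s) (ht : 0 ≤ t) (x : E) :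
    T s (T t x) = T t (T s x) := by
  rw [← hT.map_add_apply hs ht, ← hT.map_add_apply ht hs, add_comm]

/-- A bounded operator that commutes with the semigroup commutes with its generator. -/
theorem map_mem_graph (hT : GeneratesC0Semigroup A T) (L : E →L[𝕜] E)
    (hL : ∀ t, 0 ≤ t → ∀ x, T t (L x) = L (T t x)) {x y : E} (h : (x, y) ∈ A.graph) :
    (L x, L y) ∈ A.graph := by
  rw [hT.isGenerator] at h ⊢
  refine ((L.continuous.tendsto y).comp h).congr' ?_
  filter_upwards [self_mem_nhdsWithin] with t ht
  simp [hL t (le_of_lt ht)]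

theorem semigroup_mem_graph (hT : GeneratesC0Semigroup A T) {x y : E} (h : (x, y) ∈ A.graph)
    {t : ℝ} (ht : 0 ≤ t) : (T t x, T t y) ∈ A.graph :=
  hT.map_mem_graph (T t) (fun _ hs x => hT.comm_apply hs ht x) h

theorem tendsto_right (hT : GeneratesC0Semigroup A T) {x y : E} (h : (x, y) ∈ A.graph) :
    Tendsto (fun h : ℝ => h⁻¹ • (T h x - x)) (𝓝[>] 0) (𝓝 y) :=
  (hT.isGenerator x y).1 h

/-- The right derivative of `τ ↦ T τ x - x - τ • y` is `T τ y - y`, and a bound on the right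
derivative is enough for the mean value inequality. Right derivatives come directly from the
definition of the generator and the semigroup law. -/
theorem norm_map_sub_sub_le (hT : GeneratesC0Semigroup A T) {x y : E} (h : (x, y) ∈ A.graph)
    {a ε : ℝ} (ha : 0 ≤ a) (hε : ∀ τ ∈ Icc 0 a, ‖T τ y - y‖ ≤ ε) :
    ‖T a x - x - a • y‖ ≤ ε * a := by
  have key := image_norm_le_of_norm_deriv_right_le_deriv_boundary
    (f := fun τ => T τ x - x - τ • y) (f' := fun τ => T τ y - y) (a := 0) (b := a)
    (B := fun τ => ε * τ) (B' := fun _ => ε) ?_ ?_ ?_ ?_ ?_ (x := a) ⟨ha, le_rfl⟩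
  · exact key
  · have := (hT.continuousOn x).mono (Icc_subset_Ici_self : Icc 0 a ⊆ Ici 0)
    fun_prop
  · intro τ hτ
    have h1 : HasDerivWithinAt (fun τ => T τ x) (T τ y) (Ici τ) τ := by
      rw [← hasDerivWithinAt_Ioi_iff_Ici, hasDerivWithinAt_iff_tendsto_slope' (by simp)]
      have h2 : Tendsto (fun σ : ℝ => σ - τ) (𝓝[>] τ) (𝓝[>] 0) := by
        refine tendsto_nhdsWithin_iff.2 ⟨?_, ?_⟩
        · have : Continuous fun σ : ℝ => σ - τ := by fun_prop
          simpa using (this.tendsto τ).mono_left nhdsWithin_le_nhds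
        · filter_upwards [self_mem_nhdsWithin] with σ hσ
          simpa using hσ
      refine ((hT.tendsto_right (hT.semigroup_mem_graph h hτ.1)).comp h2).congr' ?_
      filter_upwards [self_mem_nhdsWithin] with σ hσ
      have hσ' : 0 ≤ σ - τ := sub_nonneg.2 (le_of_lt hσ)
      simp [slope, ← hT.map_add_apply hσ' hτ.1]
    exact (h1.sub_const x).sub (by simpa using (hasDerivWithinAt_id τ (Ici τ)).smul_const y)
  · simp [hT.map_zero]
  · intro τ
    simpa using (hasDerivAt_id τ).const_mul ε
  · exact fun τ hτ => hε τ (Ico_subset_Icc_self hτ)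

end GeneratesC0Semigroup

/-- The truncated Laplace transform `∫₀ᵃ e^{-μτ} T(τ) x dτ`. -/
noncomputable def truncatedLaplace (T : ℝ → E →L[𝕜] E) (μ a : ℝ) (x : E) : E :=
  ∫ τ in (0 : ℝ)..a, Real.exp (-(μ * τ)) • T (max τ 0) x

namespace GeneratesC0Semigroup

theorem continuous_laplace_integrand (hT : GeneratesC0Semigroup A T) (μ : ℝ) (x : E) :
    Continuous fun τ : ℝ => Real.exp (-(μ * τ)) • T (max τ 0) x := by
  exact Continuous.smul (by fun_prop) (hT.continuous_max x)

variable [CompleteSpace E]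

/-- This says `(μ - A) Q = 1 - e^{-μa} T(a)` for the truncated transform `Q`. With `μ = 0` it yields
the averages that make the domain dense; with `a` large it yields the resolvent, without improper
integrals. -/
theorem truncatedLaplace_mem_graph (hT : GeneratesC0Semigroup A T) (μ : ℝ) {a : ℝ} (ha : 0 ≤ a)
    (x : E) :
    (truncatedLaplace T μ a x,
      μ • truncatedLaplace T μ a x + Real.exp (-(μ * a)) • T a x - x) ∈ A.graph := by
  rw [hT.isGenerator]
  set u : ℝ → E := fun τ => Real.exp (-(μ * τ)) • T (max τ 0) x with hu
  have huc : Continuous u := hT.continuous_laplace_integrand μ x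
  have hint (c d : ℝ) : IntervalIntegrable u MeasureTheory.volume c d := huc.intervalIntegrable c d
  -- Shifting the variable gives `T(h) ∫₀ᵃ u = e^{μh} ∫ₕ^{a+h} u`, so the difference quotient of the
  -- semigroup is that of an elementary function of `h`.
  have hG : HasDerivAt (fun h : ℝ => Real.exp (μ * h) •
      ((∫ τ in (0 : ℝ)..(a + h), u τ) - ∫ τ in (0 : ℝ)..h, u τ))
      (Real.exp (μ * 0) • (u (a + 0) - u 0) + (Real.exp (μ * 0) * μ) •
        ((∫ τ in (0 : ℝ)..(a + 0), u τ) - ∫ τ in (0 : ℝ)..(0 : ℝ), u τ)) 0 := by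
    have h1 : HasDerivAt (fun h : ℝ => ∫ τ in (0 : ℝ)..(a + h), u τ) (u (a + 0)) 0 :=
      ((huc.integral_hasStrictDerivAt 0 (a + 0)).hasDerivAt).comp_const_add a 0
    have h2 : HasDerivAt (fun h : ℝ => ∫ τ in (0 : ℝ)..h, u τ) (u 0) 0 :=
      (huc.integral_hasStrictDerivAt 0 0).hasDerivAt
    have h3 : HasDerivAt (fun h : ℝ => Real.exp (μ * h)) (Real.exp (μ * 0) * μ) 0 := by
      simpa using ((hasDerivAt_id (0 : ℝ)).const_mul μ).exp
    exact h3.smul (h1.sub h2)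
  have h4 := hG.tendsto_slope_zero_right
  have hu0 : u 0 = x := by simp [hu, hT.map_zero]
  have hua : u a = Real.exp (-(μ * a)) • T a x := by simp [hu, ha]
  have hQ : truncatedLaplace T μ a x = ∫ τ in (0 : ℝ)..a, u τ := rfl
  simp only [add_zero, mul_zero, Real.exp_zero, one_smul, one_mul, hu0, hua, zero_add, ← hQ,
    intervalIntegral.integral_same, sub_zero] at h4
  rw [show μ • truncatedLaplace T μ a x + Real.exp (-(μ * a)) • T a x - x =
    Real.exp (-(μ * a)) • T a x - x + μ • truncatedLaplace T μ a x by abel]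
  refine h4.congr' ?_
  filter_upwards [self_mem_nhdsWithin] with h hh
  have hh0 : (0 : ℝ) ≤ h := le_of_lt hh
  congr 2
  rw [hQ, ← ContinuousLinearMap.intervalIntegral_comp_comm _ (hint 0 a),
    intervalIntegral.integral_interval_sub_left (hint _ _) (hint _ _), ← zero_add h,
    ← add_assoc, add_zero, ← intervalIntegral.integral_comp_add_right, zero_add,
    ← intervalIntegral.integral_smul]
  refine intervalIntegral.integral_congr fun τ hτ => ?_
  rw [uIcc_of_le ha] at hτ
  simp only [hu, map_real_smul_clm, max_eq_left hτ.1, max_eq_left (add_nonneg hh0 hτ.1),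
    smul_smul, ← Real.exp_add, add_comm τ h, hT.map_add_apply hh0 hτ.1]
  ring_nf

theorem tendsto_average (hT : GeneratesC0Semigroup A T) (x : E) :
    Tendsto (fun a : ℝ => a⁻¹ • truncatedLaplace T 0 a x) (𝓝[>] 0) (𝓝 x) := by
  have h := ((hT.continuous_laplace_integrand 0 x).integral_hasStrictDerivAt 0
    0).hasDerivAt.tendsto_slope_zero_right
  simpa [hT.map_zero, truncatedLaplace] using h

theorem average_mem_graph (hT : GeneratesC0Semigroup A T) {a : ℝ} (ha : 0 ≤ a) (x : E) :
    (a⁻¹ • truncatedLaplace T 0 a x, a⁻¹ • (T a x - x)) ∈ A.graph := by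
  have h := A.graph.smul_mem ((a⁻¹ : ℝ) : 𝕜) (hT.truncatedLaplace_mem_graph 0 ha x)
  simpa [← algebraMap_smul 𝕜 (a⁻¹), RCLike.algebraMap_eq_ofReal] using h

theorem exists_mem_graph_near (hT : GeneratesC0Semigroup A T) (x : E) {ε : ℝ} (hε : 0 < ε) :
    ∃ y z, (y, z) ∈ A.graph ∧ ‖y - x‖ < ε := by
  obtain ⟨a, h1, h2⟩ := (((hT.tendsto_average x).eventually (Metric.ball_mem_nhds x hε)).and
    self_mem_nhdsWithin).exists
  exact ⟨_, _, hT.average_mem_graph (le_of_lt h2) x, by simpa [dist_eq_norm] using h1⟩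

/-- The domain of the square of the generator is dense. -/
theorem exists_mem_graph_sq_near (hT : GeneratesC0Semigroup A T) (x : E) {ε : ℝ} (hε : 0 < ε) :
    ∃ y z w, (y, z) ∈ A.graph ∧ (z, w) ∈ A.graph ∧ ‖y - x‖ < ε := by
  obtain ⟨x', z', hx', hd'⟩ := hT.exists_mem_graph_near x (half_pos hε)
  obtain ⟨a, h1, h2⟩ := (((hT.tendsto_average x').eventually
    (Metric.ball_mem_nhds x' (half_pos hε))).and self_mem_nhdsWithin).exists
  have h3 := A.graph.smul_mem ((a⁻¹ : ℝ) : 𝕜)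
    (A.graph.sub_mem (hT.semigroup_mem_graph hx' (le_of_lt h2)) hx')
  have h4 := hT.average_mem_graph (le_of_lt h2) x'
  refine ⟨_, _, a⁻¹ • (T a z' - z'), h4, ?_, ?_⟩
  · simpa [← algebraMap_smul 𝕜 (a⁻¹), RCLike.algebraMap_eq_ofReal] using h3
  · calc _ = ‖(a⁻¹ • truncatedLaplace T 0 a x' - x') + (x' - x)‖ := by congr 1; abel
      _ ≤ _ := norm_add_le _ _
      _ < ε / 2 + ε / 2 := add_lt_add (by simpa [dist_eq_norm] using h1) hd'
      _ = ε := add_halves ε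

/-- The resolvent set of the generator of a semigroup of type `(M, ω)` contains all real `μ > ω`. -/
theorem exists_isResolventAt (hT : GeneratesC0Semigroup A T) {M ω μ : ℝ} (hM : 0 ≤ M)
    (hMT : IsOfType T M ω) (hμ : ω < μ) : ∃ R : E →L[𝕜] E, IsResolventAt A (μ : 𝕜) R := by
  have hsm (x : E) : (μ : 𝕜) • x = μ • x := by
    rw [← RCLike.algebraMap_eq_ofReal, algebraMap_smul]
  -- With this `a` the operator `P = e^{-μa} T(a)` is a strict contraction, so `1 - P` is invertible
  -- and the resolvent is `Q (1 - P)⁻¹`.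
  obtain ⟨a, ha0, ha⟩ : ∃ a : ℝ, 0 ≤ a ∧ M * Real.exp (-((μ - ω) * a)) < 1 := by
    have h1 : Tendsto (fun a : ℝ => M * Real.exp (-((μ - ω) * a))) atTop (𝓝 (M * 0)) :=
      ((Real.tendsto_exp_neg_atTop_nhds_zero).comp
        (tendsto_id.const_mul_atTop (sub_pos.2 hμ))).const_mul M
    rw [mul_zero] at h1
    obtain ⟨a, h2, h3⟩ := ((h1.eventually (gt_mem_nhds one_pos)).and (eventually_ge_atTop 0)).exists
    exact ⟨a, h3, h2⟩
  obtain ⟨Q, hQ⟩ : ∃ Q : E →L[𝕜] E, ∀ x, Q x = truncatedLaplace T μ a x := by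
    have hint (x : E) := (hT.continuous_laplace_integrand μ x).intervalIntegrable
      (μ := MeasureTheory.volume) 0 a
    refine ⟨LinearMap.mkContinuous
      { toFun := truncatedLaplace T μ a
        map_add' := fun x y => ?_
        map_smul' := fun c x => ?_ }
      (Real.exp (|μ| * a) * (M * Real.exp (|ω| * a)) * |a - 0|) fun x => ?_, fun x => rfl⟩
    · simp_rw [truncatedLaplace, (T _).map_add, smul_add]
      exact intervalIntegral.integral_add (hint x) (hint y)
    · simp only [truncatedLaplace, map_smul, RingHom.id_apply]
      have := ContinuousLinearMap.intervalIntegral_comp_comm (c • (1 : E →L[𝕜] E)) (hint x)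
      simpa [smul_comm c] using this
    · rw [mul_assoc _ |a - 0|, mul_comm |a - 0|, ← mul_assoc]
      refine intervalIntegral.norm_integral_le_of_norm_le_const fun τ hτ => ?_
      rw [uIoc_of_le ha0] at hτ
      rw [norm_smul, Real.norm_eq_abs, Real.abs_exp, mul_assoc]
      gcongr
      · calc -(μ * τ) ≤ |μ * τ| := neg_le_abs _
          _ = |μ| * τ := by rw [abs_mul, abs_of_pos hτ.1]
          _ ≤ |μ| * a := by gcongr; exact hτ.2
      · refine (ContinuousLinearMap.le_opNorm _ _).trans ?_
        gcongr
        exact hMT.exists_bound hM (le_max_right τ 0) (max_le hτ.2 ha0)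
  set P : E →L[𝕜] E := ((Real.exp (-(μ * a)) : ℝ) : 𝕜) • T a with hPdef
  have hP (x : E) : P x = Real.exp (-(μ * a)) • T a x := by
    rw [hPdef, smul_apply, ← RCLike.algebraMap_eq_ofReal, algebraMap_smul]
  have hPnorm : ‖P‖ < 1 := by
    refine lt_of_le_of_lt ?_ ha
    rw [hPdef, norm_smul, RCLike.norm_ofReal, Real.abs_exp]
    calc _ ≤ Real.exp (-(μ * a)) * (M * Real.exp (ω * a)) := by gcongr; exact hMT a ha0
      _ = M * Real.exp (-((μ - ω) * a)) := by
        rw [mul_left_comm, ← Real.exp_add]; ring_nf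
  have hcomm (t : ℝ) (ht : 0 ≤ t) (x : E) : T t (Q x) = Q (T t x) := by
    rw [hQ, hQ, truncatedLaplace, truncatedLaplace, ← ContinuousLinearMap.intervalIntegral_comp_comm
      _ ((hT.continuous_laplace_integrand μ x).intervalIntegrable 0 a)]
    simp only [map_real_smul_clm, hT.comm_apply ht (le_max_right _ 0)]
  have hQP : Commute Q (1 - P) := by
    ext x
    simp [hP, hcomm a ha0]
  obtain ⟨V, hV⟩ := isUnit_one_sub_of_norm_lt_one hPnorm
  have hgraph (x : E) : (Q x, μ • Q x - (1 - P) x) ∈ A.graph := by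
    have h := hT.truncatedLaplace_mem_graph μ ha0 x
    rw [← hQ, ← hP] at h
    convert h using 2
    simp
    abel
  refine ⟨Q * (↑V⁻¹ : E →L[𝕜] E), fun x => ?_, fun x => ?_⟩
  · have h := hgraph ((↑V⁻¹ : E →L[𝕜] E) x)
    rw [← hV, ← mul_apply_eq_comp (V : E →L[𝕜] E), V.mul_inv] at h
    simpa [hsm] using h
  · have h1 : (Q x, Q (A x)) ∈ A.graph := hT.map_mem_graph Q hcomm (A.mem_graph x)
    have h2 : Q (A x) = μ • Q x - (1 - P) x :=
      A.mem_graph_snd_inj h1 (hgraph x) rfl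
    have h3 : Commute Q (↑V⁻¹ : E →L[𝕜] E) := by
      rw [← hV] at hQP
      exact hQP.units_inv_right
    rw [h3.eq, hsm, mul_apply_eq_comp, map_sub, h2, map_real_smul_clm, sub_sub_cancel,
      ← hV, ← mul_apply_eq_comp, V.inv_mul]
    rfl

theorem isResolventAt_resolventOp (hT : GeneratesC0Semigroup A T) {M ω μ : ℝ} (hM : 0 ≤ M)
    (hMT : IsOfType T M ω) (hμ : ω < μ) : IsResolventAt A (μ : 𝕜) (resolventOp A (μ : 𝕜)) := by
  have h := hT.exists_isResolventAt hM hMT hμ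
  rw [resolventOp, dif_pos h]
  exact h.choose_spec

end GeneratesC0Semigroup

end SemigroupLemmas

/-! ### Chernoff's product formula for a scheme on a second space. -/

section Chernoff

variable {𝕜 E Z : Type*} [RCLike 𝕜] [NormedAddCommGroup E] [NormedSpace 𝕜 E]
  [NormedAddCommGroup Z] [NormedSpace 𝕜 Z]

/-- Chooses `l = |ω| e^{|ω|} + 1` so that `1 + l h` exceeds the growth factor `e^{ωh}` by at least
`h`; follows from `e^y - 1 ≤ y e^y` with `y = |ω| h`. -/
theorem exp_mul_le_one_add_mul (ω : ℝ) {h : ℝ} (h0 : 0 ≤ h) (h1 : h ≤ 1) :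
    Real.exp (ω * h) + h ≤ 1 + (|ω| * Real.exp |ω| + 1) * h := by
  have e1 : Real.exp (ω * h) ≤ Real.exp (|ω| * h) := by
    gcongr; exact le_abs_self ω
  have e2 : Real.exp (|ω| * h) ≤ Real.exp |ω| :=
    Real.exp_le_exp.2 (mul_le_of_le_one_right (abs_nonneg ω) h1)
  have e3 : 1 - |ω| * h ≤ Real.exp (-(|ω| * h)) := by
    linarith [Real.add_one_le_exp (-(|ω| * h))]
  have e4 : (1 - |ω| * h) * Real.exp (|ω| * h) ≤ 1 := by
    calc _ ≤ Real.exp (-(|ω| * h)) * Real.exp (|ω| * h) := by gcongr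
      _ = 1 := by rw [← Real.exp_add]; simp
  have e5 : |ω| * h * Real.exp (|ω| * h) ≤ |ω| * h * Real.exp |ω| := by gcongr
  nlinarith

theorem eventually_norm_le_of_isCompact {ι V : Type*} [NormedAddCommGroup V] [NormedSpace 𝕜 V]
    {l : Filter ι} {Ψ : ι → V →L[𝕜] Z} {C : ℝ} (hC : ∀ᶠ i in l, ‖Ψ i‖ ≤ C) {Γ K : Set V}
    (hΓ : ∀ p ∈ Γ, Tendsto (fun i => Ψ i p) l (𝓝 0)) (hK : IsCompact K) (hKΓ : K ⊆ closure Γ)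
    {ε : ℝ} (hε : 0 < ε) : ∀ᶠ i in l, ∀ p ∈ K, ‖Ψ i p‖ ≤ ε := by
  refine hK.induction_on (p := fun s => ∀ᶠ i in l, ∀ p ∈ s, ‖Ψ i p‖ ≤ ε) (by simp)
    (fun s t hst ht => ht.mono fun i hi p hp => hi p (hst hp))
    (fun s t hs ht => (hs.and ht).mono fun i hi p hp => hp.elim (hi.1 p) (hi.2 p)) fun q hq => ?_
  set r : ℝ := ε / 4 / (|C| + 1) with hr
  have hr0 : 0 < r := by positivity
  obtain ⟨p, hp, hqp⟩ := Metric.mem_closure_iff.1 (hKΓ hq) r hr0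
  refine ⟨Metric.ball q r, mem_nhdsWithin_of_mem_nhds (Metric.ball_mem_nhds q hr0), ?_⟩
  filter_upwards [hC, (hΓ p hp).norm.eventually (gt_mem_nhds (show ‖(0 : Z)‖ < ε / 2 by simpa using half_pos hε))]
    with i hi hip x hx
  have h1 : ‖x - p‖ ≤ r + r := by
    rw [← dist_eq_norm]
    exact (dist_triangle x q p).trans (add_le_add (le_of_lt hx) hqp.le)
  calc ‖Ψ i x‖ = ‖Ψ i (x - p) + Ψ i p‖ := by rw [map_sub, sub_add_cancel]
    _ ≤ ‖Ψ i‖ * ‖x - p‖ + ‖Ψ i p‖ := (norm_add_le _ _).trans (by gcongr; exact (Ψ i).le_opNorm _)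
    _ ≤ (|C| + 1) * (r + r) + ε / 2 := by
      gcongr
      linarith [le_abs_self C]
    _ = ε := by rw [hr]; field_simp; ring

/-- Telescoping: each local error is propagated by a power of `G` with norm at most `C`. -/
theorem norm_pow_apply_sub_le {G : Z →L[𝕜] Z} {C η : ℝ} (v : ℕ → Z) (n : ℕ)
    (hG : ∀ j < n, ‖G ^ j‖ ≤ C) (hv : ∀ j < n, ‖G (v j) - v (j + 1)‖ ≤ η) :
    ‖(G ^ n) (v 0) - v n‖ ≤ n * (C * η) := by
  induction n generalizing v with
  | zero => simp
  | succ n ih =>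
    have h1 := ih (fun j => v (j + 1)) (fun j hj => hG j (by omega))
      (fun j hj => hv (j + 1) (by omega))
    have h2 : (G ^ (n + 1)) (v 0) - v (n + 1) =
        (G ^ n) (G (v 0) - v 1) + ((G ^ n) (v 1) - v (n + 1)) := by
      rw [pow_succ, mul_apply_eq_comp, map_sub]; abel
    rw [h2]
    refine (norm_add_le _ _).trans ?_
    have h3 : ‖(G ^ n) (G (v 0) - v 1)‖ ≤ C * η := by
      refine (ContinuousLinearMap.le_opNorm _ _).trans ?_
      have := hG n (by omega)
      gcongr
      · exact (norm_nonneg _).trans this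
      · exact hv 0 (by omega)
    calc _ ≤ C * η + n * (C * η) := add_le_add h3 h1
      _ = _ := by push_cast; ring

variable [NormedSpace ℝ E] [NormedSpace ℝ Z]

/-- For a power bounded operator `G`, the resolvent of the difference quotient `(G - 1) / h`. -/
theorem exists_discrete_resolvent [CompleteSpace Z] (G : Z →L[𝕜] Z) {M ω l h : ℝ} (hM : 0 ≤ M)
    (h0 : 0 < h) (hl : Real.exp (ω * h) + h ≤ 1 + l * h)
    (hG : ∀ n : ℕ, ‖G ^ n‖ ≤ M * Real.exp (ω * (n * h))) :
    ∃ R : Z →L[𝕜] Z, ‖R‖ ≤ M ∧ (∀ z, R ((1 + l * h) • z - G z) = h • z) ∧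
      ∀ z, (1 + l * h) • R z - G (R z) = h • z := by
  set c : ℝ := 1 + l * h with hc
  have hexp := Real.exp_pos (ω * h)
  have hc0 : 0 < c := by linarith
  set q : ℝ := Real.exp (ω * h) / c with hq
  have hq0 : 0 ≤ q := by positivity
  have hq1 : q < 1 := by rw [hq, div_lt_one hc0]; linarith
  set Y : Z →L[𝕜] Z := ((c⁻¹ : ℝ) : 𝕜) • G with hY
  have hYa (z : Z) : Y z = c⁻¹ • G z := by
    rw [hY, smul_apply, ← RCLike.algebraMap_eq_ofReal, algebraMap_smul]
  have hYn (n : ℕ) : ‖Y ^ n‖ ≤ M * q ^ n := by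
    rw [hY, smul_pow, norm_smul, norm_pow, RCLike.norm_ofReal, abs_of_pos (inv_pos.2 hc0)]
    calc _ ≤ c⁻¹ ^ n * (M * Real.exp (ω * (n * h))) := by gcongr; exact hG n
      _ = M * q ^ n := by
        rw [hq, div_pow, ← Real.exp_nat_mul, inv_pow]; ring_nf
  have hgeo := (summable_geometric_of_lt_one hq0 hq1).mul_left M
  have hs : Summable fun n => Y ^ n := Summable.of_norm_bounded hgeo hYn
  have hsn : ‖∑' n, Y ^ n‖ ≤ M * (1 - q)⁻¹ := by
    refine (tsum_of_norm_bounded (hgeo.hasSum) hYn).trans_eq ?_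
    rw [tsum_mul_left, tsum_geometric_of_lt_one hq0 hq1]
  have e1 (z : Z) : c • z - G z = c • ((1 - Y) z) := by
    simp [hYa, smul_sub, smul_smul, hc0.ne']
  -- Neumann series for `h (c - G)⁻¹`. Its norm is at most `M h / (c - e^{ωh})`, and the gap in `hl`
  -- makes the quotient at most one.
  refine ⟨(h / c) • ∑' n, Y ^ n, ?_, fun z => ?_, fun z => ?_⟩
  · rw [norm_smul, Real.norm_of_nonneg (by positivity)]
    calc _ ≤ h / c * (M * (1 - q)⁻¹) := by gcongr
      _ = M * (h / (c - Real.exp (ω * h))) := by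
        have : c - Real.exp (ω * h) ≠ 0 := by linarith
        rw [hq, one_sub_div hc0.ne']; field_simp
      _ ≤ M * 1 := by
        gcongr
        rw [div_le_one (by linarith)]
        linarith
      _ = M := mul_one M
  · have e2 := congrArg (fun L : Z →L[𝕜] Z => L z) hs.tsum_pow_mul_one_sub
    simp only [mul_apply_eq_comp, one_apply_eq_self] at e2
    rw [e1, smul_apply, map_real_smul_clm, e2, smul_smul, div_mul_cancel₀ _ hc0.ne']
  · have e2 := congrArg (fun L : Z →L[𝕜] Z => L z) hs.one_sub_mul_tsum_pow
    simp only [mul_apply_eq_comp, one_apply_eq_self] at e2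
    rw [e1, smul_apply, map_real_smul_clm, e2, smul_smul, mul_div_cancel₀ _ hc0.ne']

variable {G : E →ₗ.[𝕜] E} {S : ℝ → E →L[𝕜] E} {Γ : Set (E × E)} {J : E →L[𝕜] Z}
  {F : ℝ → Z →L[𝕜] Z} {M ω : ℝ}

/-- Bounded approximate solutions of a consistent scheme converge uniformly on compact time
intervals, for initial values in the domain of the square of the generator. -/
theorem chernoff_of_mem_graph_sq [CompleteSpace Z] (hS : GeneratesC0Semigroup G S)
    (hSb : ∀ a : ℝ, ∃ C, ∀ t ∈ Icc 0 a, ‖S t‖ ≤ C) (hΓ : (G.graph : Set (E × E)) ⊆ closure Γ)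
    (hM : 0 ≤ M) (hF : ∀ h, 0 ≤ h → ∀ n : ℕ, ‖F h ^ n‖ ≤ M * Real.exp (ω * (n * h)))
    (hcons : ∀ p ∈ Γ, Tendsto (fun h : ℝ => h⁻¹ • (F h (J p.1) - J p.1)) (𝓝[>] 0) (𝓝 (J p.2)))
    {f k m : E} (hfk : (f, k) ∈ G.graph) (hkm : (k, m) ∈ G.graph) (a : ℝ) {ε : ℝ} (hε : 0 < ε) :
    ∀ᶠ h in 𝓝[>] (0 : ℝ), ∀ n : ℕ, n * h ≤ a → ‖(F h ^ n) (J f) - J (S (n * h) f)‖ ≤ ε := by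
  rcases lt_or_ge a 0 with ha | ha
  · filter_upwards [self_mem_nhdsWithin] with h (hh : 0 < h) n hn
    exact absurd (hn.trans_lt ha) (not_lt.2 (by positivity))
  set l : ℝ := |ω| * Real.exp |ω| + 1 with hl
  have hR : ∀ h : ℝ, ∃ R : Z →L[𝕜] Z, 0 < h → h ≤ 1 → ‖R‖ ≤ M ∧
      (∀ z, R ((1 + l * h) • z - F h z) = h • z) ∧
      ∀ z, (1 + l * h) • R z - F h (R z) = h • z := by
    intro h
    by_cases hh : 0 < h ∧ h ≤ 1
    · obtain ⟨R, hR⟩ := exists_discrete_resolvent (F h) hM hh.1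
        (exp_mul_le_one_add_mul ω hh.1.le hh.2) (hF h hh.1.le)
      exact ⟨R, fun _ _ => hR⟩
    · exact ⟨0, fun h1 h2 => absurd ⟨h1, h2⟩ hh⟩
  choose R hR using hR
  have hsmall : ∀ᶠ h in 𝓝[>] (0 : ℝ), 0 < h ∧ h ≤ 1 :=
    Ioc_mem_nhdsGT one_pos
  set D : E × E →L[𝕜] E :=
    l • ContinuousLinearMap.fst 𝕜 E E - ContinuousLinearMap.snd 𝕜 E E with hD
  -- `Ψ h` is the defect of `R h` as an approximate resolvent: on `(f, Gf)` it is `R h J (l - G) f -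
  -- J f`. It is bounded uniformly in `h` and tends to zero on `Γ` by consistency, hence uniformly
  -- on compact subsets of the graph of `G`, in particular along orbits.
  set Ψ : ℝ → E × E →L[𝕜] Z := fun h =>
    (R h).comp (J.comp D) - J.comp (ContinuousLinearMap.fst 𝕜 E E) with hΨ
  have hΨa (h : ℝ) (p : E × E) : Ψ h p = R h (J (l • p.1 - p.2)) - J p.1 := by simp [hΨ, hD]
  have hΨb : ∀ᶠ h in 𝓝[>] (0 : ℝ), ‖Ψ h‖ ≤
      M * ‖J.comp D‖ + ‖J.comp (ContinuousLinearMap.fst 𝕜 E E)‖ := by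
    filter_upwards [hsmall] with h hh
    refine (norm_sub_le _ _).trans ?_
    gcongr
    refine (ContinuousLinearMap.opNorm_comp_le _ _).trans ?_
    gcongr
    exact (hR h hh.1 hh.2).1
  have hΨ0 : ∀ p ∈ Γ, Tendsto (fun h => Ψ h p) (𝓝[>] 0) (𝓝 0) := by
    intro p hp
    have h1 : Tendsto (fun h : ℝ => M * ‖h⁻¹ • (F h (J p.1) - J p.1) - J p.2‖) (𝓝[>] 0) (𝓝 0) := by
      simpa using ((hcons p hp).sub_const (J p.2)).norm.const_mul M
    refine squeeze_zero_norm' ?_ h1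
    filter_upwards [hsmall] with h hh
    obtain ⟨hRn, hRl, -⟩ := hR h hh.1 hh.2
    have h2 : J p.1 = R h (l • J p.1 - h⁻¹ • (F h (J p.1) - J p.1)) := by
      calc J p.1 = h⁻¹ • (h • J p.1) := by rw [smul_smul, inv_mul_cancel₀ hh.1.ne', one_smul]
        _ = R h (h⁻¹ • ((1 + l * h) • J p.1 - F h (J p.1))) := by
          rw [← hRl, map_real_smul_clm]
        _ = _ := by
          congr 1
          rw [smul_sub, smul_sub, smul_smul, mul_add, mul_comm l h, ← mul_assoc,
            inv_mul_cancel₀ hh.1.ne', mul_one, one_mul, add_smul]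
          abel
    have h3 : Ψ h p = R h (h⁻¹ • (F h (J p.1) - J p.1) - J p.2) := by
      calc Ψ h p = R h (J (l • p.1 - p.2)) -
            R h (l • J p.1 - h⁻¹ • (F h (J p.1) - J p.1)) := by rw [hΨa, ← h2]
        _ = _ := by
          rw [← map_sub, map_sub J, map_real_smul J J.continuous]
          congr 1
          abel
    rw [h3]
    exact (ContinuousLinearMap.le_opNorm _ _).trans (by gcongr)
  have horbit {y z : E} (hyz : (y, z) ∈ G.graph) {η : ℝ} (hη : 0 < η) : ∀ᶠ h in 𝓝[>] (0 : ℝ),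
      ∀ t ∈ Icc 0 a, ‖R h (J (l • S t y - S t z)) - J (S t y)‖ ≤ η := by
    have hc : ContinuousOn (fun t => (S t y, S t z)) (Icc 0 a) :=
      ((hS.continuousOn y).prodMk (hS.continuousOn z)).mono Icc_subset_Ici_self
    filter_upwards [eventually_norm_le_of_isCompact hΨb hΨ0 (isCompact_Icc.image_of_continuousOn hc)
      (by rintro _ ⟨t, ht, rfl⟩; exact hΓ (hS.semigroup_mem_graph hyz ht.1)) hη] with h hh t ht
    have := hh _ (mem_image_of_mem _ ht)
    rwa [hΨa] at this
  obtain ⟨C, hC⟩ := hSb a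
  have hC0 : 0 ≤ C := (norm_nonneg _).trans (hC 0 ⟨le_rfl, ha⟩)
  -- `g = (l - G) f` and `g' = G g`; the latter exists because `f` lies in the domain of `G²`.
  obtain ⟨g, hg⟩ : ∃ g, g = l • f - k := ⟨_, rfl⟩
  obtain ⟨g', hg'⟩ : ∃ g', g' = l • k - m := ⟨_, rfl⟩
  have hgg : Tendsto (fun h : ℝ => h⁻¹ • (S h g - g)) (𝓝[>] 0) (𝓝 g') := by
    rw [hg']
    refine (((hS.tendsto_right hfk).const_smul l).sub (hS.tendsto_right hkm)).congr fun h => ?_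
    rw [hg, map_sub, map_real_smul_clm, smul_comm l, ← smul_sub, smul_sub l]
    congr 1
    abel
  set N : ℝ := M * Real.exp (|ω| * a) with hN
  have hN0 : 0 ≤ N := by positivity
  -- The three summands pay for replacing `J f` by `v 0`, for the accumulated local errors, and for
  -- replacing `v (n h)` by `J (S (n h) f)`.
  obtain ⟨η, hη0, hη⟩ : ∃ η : ℝ, 0 < η ∧
      N * η + (a * (N * (l * η + η + M * (‖J‖ * (C * η))))) + η ≤ ε := by
    obtain ⟨K, hK⟩ : ∃ K, K = N + a * (N * (l + 1 + M * (‖J‖ * C))) + 1 := ⟨_, rfl⟩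
    have hK0 : 0 < K := by rw [hK]; positivity
    refine ⟨ε / K, by positivity, le_of_eq ?_⟩
    calc _ = (N + a * (N * (l + 1 + M * (‖J‖ * C))) + 1) * (ε / K) := by ring
      _ = ε := by rw [← hK, mul_div_cancel₀ _ hK0.ne']
  filter_upwards [hsmall, horbit hfk hη0, horbit hkm hη0,
    (hgg.sub_const g').norm.eventually (gt_mem_nhds (by simpa using hη0))]
    with h ⟨hh0, hh1⟩ H1 H2 H3 n hn
  obtain ⟨hRn, -, hRr⟩ := hR h hh0 hh1
  have hFn (j : ℕ) (hj : j ≤ n) : ‖F h ^ j‖ ≤ N := by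
    refine (hF h hh0.le j).trans ?_
    rw [hN]
    have : (j : ℝ) * h ≤ a := le_trans (by gcongr) hn
    gcongr
    exact le_abs_self ω
  -- `v t` is close to `J (S t f)` but lies in the range of `R h`, so one step of `F h` on it is
  -- explicit: both `F h (v t) - v t` and `v (t + h) - v t` are `h • J (S t k)` up to `o(h)`.
  set v : ℝ → Z := fun t => R h (J (S t g)) with hv
  have hSg (t : ℝ) : S t g = l • S t f - S t k := by rw [hg, map_sub, map_real_smul_clm]
  have hstep (t : ℝ) (ht : t ∈ Icc 0 a) :
      ‖F h (v t) - v (t + h)‖ ≤ h * (l * η + η + M * (‖J‖ * (C * η))) := by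
    have e1 : F h (v t) = v t + h • (l • v t - J (S t g)) := by
      have := hRr (J (S t g))
      rw [sub_eq_iff_eq_add, ← sub_eq_iff_eq_add'] at this
      rw [hv, ← this]
      module
    have e2 : v (t + h) = v t + h • R h (J (S t (h⁻¹ • (S h g - g)))) := by
      have e0 : S t (S h g) = S t g + h • S t (h⁻¹ • (S h g - g)) := by
        rw [← map_real_smul_clm, smul_inv_smul₀ hh0.ne', ← map_add, add_sub_cancel]
      simp only [hv]
      rw [hS.map_add_apply ht.1 hh0.le, e0, map_add J, map_real_smul J J.continuous, map_add (R h),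
        map_real_smul_clm (R h)]
    have e3 : F h (v t) - v (t + h) = h • (l • (v t - J (S t f))
        - (R h (J (l • S t k - S t m)) - J (S t k))
        - R h (J (S t (h⁻¹ • (S h g - g) - g')))) := by
      have e4 : S t g' = l • S t k - S t m := by rw [hg', map_sub, map_real_smul_clm]
      rw [e1, e2, map_sub (S t) _ g', e4, map_sub J (S t (h⁻¹ • (S h g - g))),
        map_sub (R h) (J (S t (h⁻¹ • (S h g - g)))), hSg t, map_sub J (l • S t f),
        map_real_smul J J.continuous l (S t f)]
      module
    rw [e3, norm_smul, Real.norm_of_nonneg hh0.le]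
    gcongr
    refine (norm_sub_le _ _).trans (add_le_add ((norm_sub_le _ _).trans (add_le_add ?_ ?_)) ?_)
    · rw [norm_smul, Real.norm_of_nonneg (by positivity)]
      gcongr
      simp only [hv]
      rw [hSg]
      exact H1 t ht
    · exact H2 t ht
    · refine (ContinuousLinearMap.le_opNorm _ _).trans ?_
      gcongr
      refine (ContinuousLinearMap.le_opNorm _ _).trans ?_
      gcongr
      refine (ContinuousLinearMap.le_opNorm _ _).trans ?_
      gcongr
      exact hC t ht
  have htele := norm_pow_apply_sub_le (G := F h) (fun j : ℕ => v (j * h)) n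
    (fun j hj => hFn j hj.le) (η := h * (l * η + η + M * (‖J‖ * (C * η)))) fun j hj => by
      have hj' : (j : ℝ) * h ≤ a := le_trans (by gcongr) hn
      have := hstep (j * h) ⟨by positivity, hj'⟩
      simpa [add_mul] using this
  have hnh : (n : ℝ) * h ∈ Icc 0 a := ⟨by positivity, hn⟩
  have f1 : ‖(F h ^ n) (J f - v 0)‖ ≤ N * η := by
    refine (ContinuousLinearMap.le_opNorm _ _).trans ?_
    gcongr
    · exact hFn n le_rfl
    · have := H1 0 ⟨le_rfl, ha⟩
      rw [← hSg, norm_sub_rev] at this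
      simpa [hS.map_zero, hv] using this
  have f2 : ‖v (n * h) - J (S (n * h) f)‖ ≤ η := by
    have := H1 _ hnh
    rwa [← hSg] at this
  have f3 : (n : ℝ) * (N * (h * (l * η + η + M * (‖J‖ * (C * η))))) ≤
      a * (N * (l * η + η + M * (‖J‖ * (C * η)))) := by
    calc _ = (n * h) * (N * (l * η + η + M * (‖J‖ * (C * η)))) := by ring
      _ ≤ _ := by gcongr
  calc _ = ‖(F h ^ n) (J f - v 0) + ((F h ^ n) (v 0) - v (n * h)) +
        (v (n * h) - J (S (n * h) f))‖ := by rw [map_sub]; congr 1; abel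
    _ ≤ N * η + (a * (N * (l * η + η + M * (‖J‖ * (C * η))))) + η := by
      refine (norm_add_le _ _).trans (add_le_add ((norm_add_le _ _).trans (add_le_add f1 ?_)) f2)
      exact le_trans (by simpa using htele) f3
    _ ≤ ε := hη

/-- Chernoff's product formula for approximations acting on a larger space: the scheme `F` on `Z` is
power bounded and consistent with the semigroup `S` on `E` on a core `Γ` of its generator. -/
theorem chernoff [CompleteSpace E] [CompleteSpace Z] (hS : GeneratesC0Semigroup G S)
    (hSb : ∀ a : ℝ, ∃ C, ∀ t ∈ Icc 0 a, ‖S t‖ ≤ C) (hΓ : (G.graph : Set (E × E)) ⊆ closure Γ)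
    (hM : 0 ≤ M) (hF : ∀ h, 0 ≤ h → ∀ n : ℕ, ‖F h ^ n‖ ≤ M * Real.exp (ω * (n * h)))
    (hcons : ∀ p ∈ Γ, Tendsto (fun h : ℝ => h⁻¹ • (F h (J p.1) - J p.1)) (𝓝[>] 0) (𝓝 (J p.2)))
    (f : E) (a : ℝ) {ε : ℝ} (hε : 0 < ε) :
    ∀ᶠ h in 𝓝[>] (0 : ℝ), ∀ n : ℕ, n * h ≤ a → ‖(F h ^ n) (J f) - J (S (n * h) f)‖ ≤ ε := by
  obtain ⟨C, hC⟩ := hSb a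
  set N : ℝ := M * Real.exp (|ω| * a) with hN
  obtain ⟨δ, hδ0, hδ⟩ : ∃ δ : ℝ, 0 < δ ∧ (N * ‖J‖ + ‖J‖ * |C| + 1) * δ = ε / 2 :=
    ⟨ε / 2 / (N * ‖J‖ + ‖J‖ * |C| + 1), by positivity, mul_div_cancel₀ _ (by positivity)⟩
  obtain ⟨y, z, w, hyz, hzw, hy⟩ := hS.exists_mem_graph_sq_near f hδ0
  filter_upwards [self_mem_nhdsWithin,
    chernoff_of_mem_graph_sq hS hSb hΓ hM hF hcons hyz hzw a (half_pos hε)] with h (hh : 0 < h) H n hn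
  have h1 : ‖(F h ^ n) (J (f - y))‖ ≤ N * (‖J‖ * δ) := by
    refine (ContinuousLinearMap.le_opNorm _ _).trans ?_
    gcongr
    · refine (hF h hh.le n).trans ?_
      rw [hN]
      gcongr
      exact le_abs_self ω
    · refine (ContinuousLinearMap.le_opNorm _ _).trans ?_
      gcongr
      rw [norm_sub_rev]
      exact hy.le
  have h2 : ‖J (S (n * h) (y - f))‖ ≤ ‖J‖ * (|C| * δ) := by
    refine (ContinuousLinearMap.le_opNorm _ _).trans ?_
    gcongr
    refine (ContinuousLinearMap.le_opNorm _ _).trans ?_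
    gcongr
    exact (hC _ ⟨by positivity, hn⟩).trans (le_abs_self C)
  calc _ = ‖(F h ^ n) (J (f - y)) + ((F h ^ n) (J y) - J (S (n * h) y)) + J (S (n * h) (y - f))‖ := by
        simp only [map_sub]; congr 1; abel
    _ ≤ N * (‖J‖ * δ) + ε / 2 + ‖J‖ * (|C| * δ) :=
      (norm_add_le _ _).trans (add_le_add ((norm_add_le _ _).trans (add_le_add h1 (H n hn))) h2)
    _ ≤ ε := by linarith

end Chernoff

/-! ### Consistency of the splitting, uniformly in time. -/

section Uniformity

theorem eventually_forall_of_eventually_prod {ι α : Type*} [TopologicalSpace α] {l : Filter ι}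
    {P : ι → α → Prop} (hloc : ∀ r₀, ∀ᶠ z in l ×ˢ 𝓝 r₀, P z.1 z.2)
    (hinf : ∀ᶠ z in l ×ˢ cocompact α, P z.1 z.2) : ∀ᶠ i in l, ∀ r, P i r := by
  obtain ⟨p, hp, q, hq, hpq⟩ := eventually_prod_iff.1 hinf
  obtain ⟨K, hK, hKq⟩ := mem_cocompact.1 hq
  have h1 : ∀ᶠ i in l, ∀ r ∈ K, P i r := by
    refine hK.induction_on (p := fun s => ∀ᶠ i in l, ∀ r ∈ s, P i r) (by simp)
      (fun s t hst ht => ht.mono fun i hi r hr => hi r (hst hr))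
      (fun s t hs ht => (hs.and ht).mono fun i hi r hr => hr.elim (hi.1 r) (hi.2 r)) fun r _ => ?_
    obtain ⟨p', hp', q', hq', hpq'⟩ := eventually_prod_iff.1 (hloc r)
    exact ⟨{r | q' r}, mem_nhdsWithin_of_mem_nhds hq', hp'.mono fun i hi r hr => hpq' hi hr⟩
  filter_upwards [h1, hp] with i hi hpi r
  by_cases hr : r ∈ K
  · exact hi r hr
  · exact hpq hpi (hKq hr)

theorem c0_eventually_norm_le {α E : Type*} [TopologicalSpace α] [NormedAddCommGroup E]
    (f : C₀(α, E)) {ε : ℝ} (hε : 0 < ε) : ∀ᶠ r in cocompact α, ‖f r‖ ≤ ε := by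
  have h := f.zero_at_infty'.norm.eventually (ge_mem_nhds (show ‖(0 : E)‖ < ε by simpa using hε))
  exact h

theorem c0_norm_le {α E : Type*} [TopologicalSpace α] [NormedAddCommGroup E] {f : C₀(α, E)} {C : ℝ}
    (hC : 0 ≤ C) (h : ∀ r, ‖f r‖ ≤ C) : ‖f‖ ≤ C := by
  rw [← ZeroAtInftyContinuousMap.norm_toBCF_eq_norm]
  exact (BoundedContinuousFunction.norm_le hC).2 h

theorem c0_norm_apply_le {α E : Type*} [TopologicalSpace α] [NormedAddCommGroup E] (f : C₀(α, E))
    (r : α) : ‖f r‖ ≤ ‖f‖ := by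
  rw [← ZeroAtInftyContinuousMap.norm_toBCF_eq_norm]
  exact f.toBCF.norm_coe_le_norm r

theorem eventually_forall_translate_sub_le {X : Type*} [NormedAddCommGroup X]
    [NormedSpace ℝ X] {f d : C₀(ℝ, X)}
    (hd : ∀ s, HasDerivAt (fun r => f r) (d s) s) {ε : ℝ} (hε : 0 < ε) :
    ∀ᶠ h in 𝓝[≥] (0 : ℝ), ∀ s, ‖f (s - h) - f s + h • d s‖ ≤ ε * h := by
  obtain ⟨δ, hδ0, hδ⟩ := Metric.uniformContinuous_iff.1
    (ZeroAtInftyContinuousMap.uniformContinuous d) ε hε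
  filter_upwards [Ico_mem_nhdsGE hδ0] with h hh s
  have h1 := Convex.norm_image_sub_le_of_norm_hasDerivWithin_le (f := fun r => f r - r • d s)
    (f' := fun r => d r - d s) (s := Icc (s - h) s) (x := s) (y := s - h) (C := ε) ?_ ?_
    (convex_Icc _ _) ⟨by linarith [hh.1], le_rfl⟩ ⟨le_rfl, by linarith [hh.1]⟩
  · have e : ‖s - h - s‖ = h := by
      rw [show s - h - s = -h by ring, norm_neg, Real.norm_of_nonneg hh.1]
    rw [e] at h1
    convert h1 using 2
    module
  · intro r _
    simpa using! ((hd r).fun_sub ((hasDerivAt_id' r).smul_const (d s))).hasDerivWithinAt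
  · intro r hr
    rw [← dist_eq_norm]
    refine (hδ ?_).le
    rw [Real.dist_eq, abs_lt]
    constructor <;> linarith [hr.1, hr.2, hh.2]

variable {𝕜 X : Type*} [RCLike 𝕜] [NormedAddCommGroup X] [NormedSpace 𝕜 X] [NormedSpace ℝ X]
  [CompleteSpace X]

/-- A family of semigroups of the same type whose resolvents depend strongly continuously on the
parameter is strongly continuous at time zero uniformly along functions in `C₀`. -/
theorem eventually_forall_semigroup_sub_le {A : ℝ → X →ₗ.[𝕜] X} {T : ℝ → ℝ → X →L[𝕜] X}
    {M ω μ : ℝ} (hM : 0 ≤ M) (hT : ∀ r, GeneratesC0Semigroup (A r) (T r))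
    (hMT : ∀ r, IsOfType (T r) M ω) (hμ : ω < μ)
    (hcont : ∀ x : X, Continuous fun r => resolventOp (A r) (μ : 𝕜) x) (a : C₀(ℝ, X)) {ε : ℝ}
    (hε : 0 < ε) : ∀ᶠ τ in 𝓝[≥] (0 : ℝ), ∀ r, ‖T r τ (a r) - a r‖ ≤ ε := by
  set N : ℝ := M * Real.exp (|ω| * 1) with hN
  have hN0 : 0 ≤ N := by positivity
  have hsmall : ∀ᶠ τ in 𝓝[≥] (0 : ℝ), 0 ≤ τ ∧ τ ≤ 1 := Icc_mem_nhdsGE one_pos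
  have hTN {r τ : ℝ} (hτ : 0 ≤ τ ∧ τ ≤ 1) : ‖T r τ‖ ≤ N := (hMT r).exists_bound hM hτ.1 hτ.2
  have hdiff {r τ : ℝ} (hτ : 0 ≤ τ ∧ τ ≤ 1) (y : X) : ‖T r τ y - y‖ ≤ (N + 1) * ‖y‖ := by
    calc _ ≤ ‖T r τ y‖ + ‖y‖ := norm_sub_le _ _
      _ ≤ N * ‖y‖ + ‖y‖ := by
        gcongr
        exact (ContinuousLinearMap.le_opNorm _ _).trans (by gcongr; exact hTN hτ)
      _ = _ := by ring
  refine eventually_forall_of_eventually_prod (fun r₀ => ?_) ?_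
  · obtain ⟨η, hη0, hη⟩ : ∃ η : ℝ, 0 < η ∧ (N + 1) * (3 * η) = ε / 2 :=
      ⟨ε / 2 / (N + 1) / 3, by positivity, by field_simp⟩
    obtain ⟨x₀, z₀, hx₀, hy₀⟩ := (hT r₀).exists_mem_graph_near (a r₀) hη0
    -- For `r` near `r₀` the vectors `R(μ, A(r)) z` lie in `D(A(r))`, stay close to `x₀`, and have
    -- images under `A(r)` bounded by `B`. The semigroups therefore move them by `O(τ)` uniformly in
    -- `r`. At infinity `a` itself is small.
    set z : X := μ • x₀ - z₀ with hz
    set B : ℝ := |μ| * (‖x₀‖ + η) + ‖z‖ with hB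
    have hB0 : 0 ≤ B := by positivity
    have hres (r : ℝ) := (hT r).isResolventAt_resolventOp hM (hMT r) hμ
    have hsm (x : X) : (μ : 𝕜) • x = μ • x := by
      rw [← RCLike.algebraMap_eq_ofReal, algebraMap_smul]
    have hR₀ : resolventOp (A r₀) (μ : 𝕜) z = x₀ := by
      obtain ⟨w, hw1, hw2⟩ := (A r₀).mem_graph_iff.1 hx₀
      have := (hres r₀).2 w
      rwa [hsm, hw1, hw2] at this
    have e1 : ∀ᶠ r in 𝓝 r₀, ‖resolventOp (A r) (μ : 𝕜) z - x₀‖ < η := by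
      have := (hcont z).tendsto r₀
      rw [hR₀] at this
      simpa [dist_eq_norm] using this.eventually (Metric.ball_mem_nhds x₀ hη0)
    have e2 : ∀ᶠ r in 𝓝 r₀, ‖a r - a r₀‖ < η := by
      simpa [dist_eq_norm] using ((map_continuous a).tendsto r₀).eventually
        (Metric.ball_mem_nhds (a r₀) hη0)
    have e3 : ∀ᶠ τ in 𝓝[≥] (0 : ℝ), (B + (N + 1) * B) * τ ≤ ε / 2 := by
      have : Continuous fun τ : ℝ => (B + (N + 1) * B) * τ := by fun_prop
      exact ((this.tendsto' 0 0 (by simp)).mono_left nhdsWithin_le_nhds).eventually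
        (ge_mem_nhds (half_pos hε))
    filter_upwards [(hsmall.and e3).prod_mk (e1.and e2)] with ⟨τ, r⟩ ⟨⟨hτ, h3⟩, h1, h2⟩
    set x := resolventOp (A r) (μ : 𝕜) z with hx
    have hg : (x, μ • x - z) ∈ (A r).graph := by
      have := (hres r).1 z
      rwa [hsm] at this
    have hy : ‖μ • x - z‖ ≤ B := by
      refine (norm_sub_le _ _).trans (add_le_add_left ?_ _)
      rw [norm_smul, Real.norm_eq_abs]
      gcongr
      calc ‖x‖ = ‖x₀ + (x - x₀)‖ := by rw [add_sub_cancel]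
        _ ≤ _ := (norm_add_le _ _).trans (by gcongr)
    have f1 := (hT r).norm_map_sub_sub_le hg (ε := (N + 1) * B) hτ.1 fun σ hσ =>
      (hdiff ⟨hσ.1, hσ.2.trans hτ.2⟩ _).trans (by gcongr)
    have f2 : ‖T r τ x - x‖ ≤ ε / 2 := by
      calc _ = ‖(T r τ x - x - τ • (μ • x - z)) + τ • (μ • x - z)‖ := by rw [sub_add_cancel]
        _ ≤ (N + 1) * B * τ + τ * B := by
          refine (norm_add_le _ _).trans (add_le_add f1 ?_)
          rw [norm_smul, Real.norm_of_nonneg hτ.1]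
          exact mul_le_mul_of_nonneg_left hy hτ.1
        _ ≤ ε / 2 := by linarith
    have f3 : ‖a r - x‖ ≤ 3 * η := by
      calc _ = ‖(a r - a r₀) - (x₀ - a r₀) - (x - x₀)‖ := by congr 1; abel
        _ ≤ ‖a r - a r₀‖ + ‖x₀ - a r₀‖ + ‖x - x₀‖ :=
          (norm_sub_le _ _).trans (by gcongr; exact norm_sub_le _ _)
        _ ≤ 3 * η := by linarith
    calc ‖T r τ (a r) - a r‖ = ‖(T r τ (a r - x) - (a r - x)) + (T r τ x - x)‖ := by
          rw [map_sub]; congr 1; abel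
      _ ≤ (N + 1) * (3 * η) + ε / 2 := (norm_add_le _ _).trans
          (add_le_add ((hdiff hτ _).trans (by gcongr)) f2)
      _ = ε := by rw [hη, add_halves]
  · have hη0 : 0 < ε / (N + 1) := by positivity
    filter_upwards [hsmall.prod_mk (c0_eventually_norm_le a hη0)] with ⟨τ, r⟩ ⟨hτ, hr⟩
    calc _ ≤ (N + 1) * ‖a r‖ := hdiff hτ _
      _ ≤ (N + 1) * (ε / (N + 1)) := by gcongr
      _ = ε := by field_simp

theorem eventually_forall_semigroup_sub_sub_le {A : ℝ → X →ₗ.[𝕜] X} {T : ℝ → ℝ → X →L[𝕜] X}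
    {M ω μ : ℝ} (hM : 0 ≤ M) (hT : ∀ r, GeneratesC0Semigroup (A r) (T r))
    (hMT : ∀ r, IsOfType (T r) M ω) (hμ : ω < μ)
    (hcont : ∀ x : X, Continuous fun r => resolventOp (A r) (μ : 𝕜) x) {f : ℝ → X} {a : C₀(ℝ, X)}
    (hfa : ∀ r, (f r, a r) ∈ (A r).graph) {ε : ℝ} (hε : 0 < ε) :
    ∀ᶠ h in 𝓝[≥] (0 : ℝ), ∀ r, ‖T r h (f r) - f r - h • a r‖ ≤ ε * h := by
  obtain ⟨δ, hδ0, hδ⟩ := mem_nhdsGE_iff_exists_Ico_subset.1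
    (eventually_forall_semigroup_sub_le hM hT hMT hμ hcont a hε)
  filter_upwards [Ico_mem_nhdsGE hδ0] with h hh r
  exact (hT r).norm_map_sub_sub_le (hfa r) hh.1 fun τ hτ =>
    hδ ⟨hτ.1, hτ.2.trans_lt hh.2⟩ r

/-- Consistency of the Lie splitting with the operator `-d/ds + A(·) + B(·)`. -/
theorem eventually_forall_splitting_sub_le {A B : ℝ → X →ₗ.[𝕜] X} {S T : ℝ → ℝ → X →L[𝕜] X}
    {M ω μ : ℝ} (hM : 0 ≤ M) (hS : ∀ r, GeneratesC0Semigroup (A r) (S r))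
    (hMS : ∀ r, IsOfType (S r) M ω) (hT : ∀ r, GeneratesC0Semigroup (B r) (T r))
    (hMT : ∀ r, IsOfType (T r) M ω) (hμ : ω < μ)
    (hA : ∀ x : X, Continuous fun r => resolventOp (A r) (μ : 𝕜) x)
    (hB : ∀ x : X, Continuous fun r => resolventOp (B r) (μ : 𝕜) x) {f d a b : C₀(ℝ, X)}
    (hd : ∀ s, HasDerivAt (fun r => f r) (d s) s) (ha : ∀ r, (f r, a r) ∈ (A r).graph)
    (hb : ∀ r, (f r, b r) ∈ (B r).graph) {ε : ℝ} (hε : 0 < ε) :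
    ∀ᶠ h in 𝓝[≥] (0 : ℝ), ∀ s, ‖T (s - h) h (S (s - h) h (f (s - h))) - f s
      - h • (-d s + a s + b s)‖ ≤ ε * h := by
  set N : ℝ := M * Real.exp (|ω| * 1) with hN
  have hN0 : 0 ≤ N := by positivity
  obtain ⟨η, hη0, hη⟩ : ∃ η : ℝ, 0 < η ∧ (N + 4) * η = ε :=
    ⟨ε / (N + 4), by positivity, by field_simp⟩
  obtain ⟨δ, hδ0, hδ⟩ := Metric.uniformContinuous_iff.1
    (ZeroAtInftyContinuousMap.uniformContinuous (a + b)) η hη0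
  filter_upwards [Icc_mem_nhdsGE one_pos, Ico_mem_nhdsGE hδ0,
    eventually_forall_semigroup_sub_sub_le hM hS hMS hμ hA ha hη0,
    eventually_forall_semigroup_sub_sub_le hM hT hMT hμ hB hb hη0,
    eventually_forall_semigroup_sub_le hM hT hMT hμ hB a hη0,
    eventually_forall_translate_sub_le hd hη0] with h hh hhδ h1 h2 h3 h4 s
  set r := s - h with hr
  have e1 : ‖T r h (S r h (f r) - f r - h • a r)‖ ≤ N * (η * h) := by
    refine (ContinuousLinearMap.le_opNorm _ _).trans ?_
    gcongr
    · exact (hMT r).exists_bound hM hh.1 hh.2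
    · exact h1 r
  have e2 : ‖h • (T r h (a r) - a r)‖ ≤ η * h := by
    rw [norm_smul, Real.norm_of_nonneg hh.1, mul_comm]
    gcongr
    · exact hh.1
    · exact h3 r
  have e3 : ‖h • ((a r + b r) - (a s + b s))‖ ≤ η * h := by
    rw [norm_smul, Real.norm_of_nonneg hh.1, mul_comm, ← dist_eq_norm]
    have : dist r s < δ := by
      rw [hr, Real.dist_eq, show s - h - s = -h by ring, abs_neg, abs_of_nonneg hh.1]
      exact hhδ.2
    exact mul_le_mul_of_nonneg_right (hδ this).le hh.1
  -- The five errors: the `A`-step carried along by the `B`-semigroup (factor `N`), the action of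
  -- that semigroup on `a r`, the `B`-step, the translation, and the shift of `a + b` from `r` to
  -- `s`.
  calc _ = ‖T r h (S r h (f r) - f r - h • a r) + h • (T r h (a r) - a r)
        + (T r h (f r) - f r - h • b r) + (f r - f s + h • d s)
        + h • ((a r + b r) - (a s + b s))‖ := by
        rw [map_sub (T r h), map_sub (T r h), map_real_smul_clm]; congr 1; module
    _ ≤ N * (η * h) + η * h + η * h + η * h + η * h := by
        refine (norm_add_le _ _).trans (add_le_add ((norm_add_le _ _).trans (add_le_add
          ((norm_add_le _ _).trans (add_le_add ((norm_add_le _ _).trans (add_le_add e1 e2))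
            (h2 r))) (h4 s))) e3)
    _ = ε * h := by rw [← hη]; ring

end Uniformity

/-! ### Strong continuity of the evolution semigroup on `C₀(ℝ, X)`. -/

section EvolutionSemigroup

variable {𝕜 X : Type*} [RCLike 𝕜] [NormedAddCommGroup X] [NormedSpace 𝕜 X]
  {W : ℝ → ℝ → X →L[𝕜] X}

theorem IsEvolutionFamily.exists_norm_le (hW : IsEvolutionFamily W) (a : ℝ) :
    ∃ C, 0 ≤ C ∧ ∀ t ∈ Icc 0 a, ∀ s, ‖W s (s - t)‖ ≤ C := by
  obtain ⟨M, ω, hM, hb⟩ := hW.bound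
  refine ⟨M * Real.exp (|ω| * a), by positivity, fun t ht s => ?_⟩
  refine (hb s (s - t) (by linarith [ht.1])).trans ?_
  rw [sub_sub_cancel]
  gcongr
  · exact ht.1
  · exact le_abs_self ω
  · exact ht.2

theorem IsEvolutionFamily.tendsto_orbit (hW : IsEvolutionFamily W) (f : C₀(ℝ, X)) {t₀ : ℝ}
    (ht₀ : 0 ≤ t₀) (s₀ : ℝ) :
    Tendsto (fun z : ℝ × ℝ => W z.2 (z.2 - z.1) (f (z.2 - z.1))) (𝓝[Ici 0] t₀ ×ˢ 𝓝 s₀)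
      (𝓝 (W s₀ (s₀ - t₀) (f (s₀ - t₀)))) := by
  obtain ⟨C, hC0, hC⟩ := hW.exists_norm_le (t₀ + 1)
  have hfilter : 𝓝[Ici 0] t₀ ×ˢ 𝓝 s₀ = 𝓝[Ici 0 ×ˢ univ] (t₀, s₀) := by
    rw [nhdsWithin_prod_eq, nhdsWithin_univ]
  have hsmall : ∀ᶠ z : ℝ × ℝ in 𝓝[Ici 0] t₀ ×ˢ 𝓝 s₀, z.1 ∈ Icc 0 (t₀ + 1) := by
    have : ∀ᶠ t in 𝓝[Ici 0] t₀, t ∈ Icc 0 (t₀ + 1) := by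
      filter_upwards [self_mem_nhdsWithin,
        mem_nhdsWithin_of_mem_nhds (Iic_mem_nhds (lt_add_one t₀))] with t h1 h2 using ⟨h1, h2⟩
    exact this.prod_inl _
  have h1 : Tendsto (fun z : ℝ × ℝ => W z.2 (z.2 - z.1) (f (s₀ - t₀))) (𝓝[Ici 0] t₀ ×ˢ 𝓝 s₀)
      (𝓝 (W s₀ (s₀ - t₀) (f (s₀ - t₀)))) := by
    have hc : ContinuousOn (fun z : ℝ × ℝ => W z.2 (z.2 - z.1) (f (s₀ - t₀))) (Ici 0 ×ˢ univ) :=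
      (hW.continuousOn (f (s₀ - t₀))).comp (f := fun z : ℝ × ℝ => (z.2, z.2 - z.1)) (by fun_prop)
        fun z hz => by simpa using hz.1
    rw [hfilter]
    exact hc (t₀, s₀) ⟨ht₀, mem_univ _⟩
  have h2 : Tendsto (fun z : ℝ × ℝ => W z.2 (z.2 - z.1) (f (z.2 - z.1) - f (s₀ - t₀)))
      (𝓝[Ici 0] t₀ ×ˢ 𝓝 s₀) (𝓝 0) := by
    have hc : Continuous fun z : ℝ × ℝ => C * ‖f (z.2 - z.1) - f (s₀ - t₀)‖ := by fun_prop
    have h3 : Tendsto (fun z : ℝ × ℝ => C * ‖f (z.2 - z.1) - f (s₀ - t₀)‖)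
        (𝓝[Ici 0] t₀ ×ˢ 𝓝 s₀) (𝓝 0) := by
      rw [hfilter]
      exact (hc.tendsto' (t₀, s₀) 0 (by simp)).mono_left nhdsWithin_le_nhds
    refine squeeze_zero_norm' ?_ h3
    filter_upwards [hsmall] with z hz
    exact (ContinuousLinearMap.le_opNorm _ _).trans (by gcongr; exact hC _ hz _)
  simpa using h2.add h1

theorem IsEvolutionFamily.eventually_norm_orbit_le (hW : IsEvolutionFamily W) (f : C₀(ℝ, X))
    (t₀ : ℝ) {ε : ℝ} (hε : 0 < ε) :
    ∀ᶠ z in 𝓝[Ici 0] t₀ ×ˢ cocompact ℝ, ‖W z.2 (z.2 - z.1) (f (z.2 - z.1))‖ ≤ ε := by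
  obtain ⟨C, hC0, hC⟩ := hW.exists_norm_le (|t₀| + 1)
  have hsmall : ∀ᶠ t in 𝓝[Ici 0] t₀, t ∈ Icc 0 (|t₀| + 1) := by
    have : t₀ < |t₀| + 1 := by linarith [le_abs_self t₀]
    filter_upwards [self_mem_nhdsWithin,
      mem_nhdsWithin_of_mem_nhds (Iic_mem_nhds this)] with t h1 h2 using ⟨h1, h2⟩
  have hη : 0 < ε / (C + 1) := by positivity
  have hf := c0_eventually_norm_le f hη
  -- A radius beyond which `f` is small is needed, because `s - t` must stay outside it for all
  -- bounded `t` at once.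
  rw [← Metric.cobounded_eq_cocompact, ← comap_norm_atTop, eventually_comap,
    eventually_atTop] at hf
  obtain ⟨ρ, hρ⟩ := hf
  have hlarge : ∀ᶠ s in cocompact ℝ, ρ + (|t₀| + 1) ≤ ‖s‖ :=
    (tendsto_norm_cocompact_atTop (E := ℝ)).eventually (eventually_ge_atTop _)
  filter_upwards [hsmall.prod_mk hlarge] with ⟨t, s⟩ ⟨ht, hs⟩
  have h1 : ‖f (s - t)‖ ≤ ε / (C + 1) := by
    refine hρ ‖s - t‖ ?_ _ rfl
    have h2 := norm_sub_norm_le s t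
    rw [Real.norm_of_nonneg ht.1] at h2
    linarith [ht.2]
  calc _ ≤ C * (ε / (C + 1)) :=
        (ContinuousLinearMap.le_opNorm _ _).trans (by gcongr; exact hC _ ht _)
    _ ≤ (C + 1) * (ε / (C + 1)) := by gcongr; linarith
    _ = ε := by field_simp

theorem IsEvolutionFamily.generatesC0Semigroup [NormedSpace ℝ X] (hW : IsEvolutionFamily W)
    {G : C₀(ℝ, X) →ₗ.[𝕜] C₀(ℝ, X)} (hG : IsGenerator G (evolutionSemigroup W hW)) :
    GeneratesC0Semigroup G (evolutionSemigroup W hW) where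
  map_zero := by
    ext f s
    simp [evolutionSemigroup_apply hW le_rfl, hW.refl]
  map_add s t hs ht := by
    ext f r
    rw [mul_apply_eq_comp, evolutionSemigroup_apply hW (add_nonneg hs ht),
      evolutionSemigroup_apply hW hs, evolutionSemigroup_apply hW ht, ← mul_apply_eq_comp,
      hW.comp _ _ _ (by linarith) (by linarith), sub_sub]
  continuousOn f := by
    intro t₀ (ht₀ : 0 ≤ t₀)
    rw [ContinuousWithinAt, Metric.tendsto_nhds]
    intro ε hε
    have key : ∀ᶠ t in 𝓝[Ici 0] t₀, ∀ s,
        ‖W s (s - t) (f (s - t)) - W s (s - t₀) (f (s - t₀))‖ ≤ ε / 2 := by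
      refine eventually_forall_of_eventually_prod (fun s₀ => ?_) ?_
      · have h1 := hW.tendsto_orbit f ht₀ s₀
        have h2 : Tendsto (fun z : ℝ × ℝ => W z.2 (z.2 - t₀) (f (z.2 - t₀)))
            (𝓝[Ici 0] t₀ ×ˢ 𝓝 s₀) (𝓝 (W s₀ (s₀ - t₀) (f (s₀ - t₀)))) :=
          ((hW.continuous_shift ht₀ f).tendsto s₀).comp tendsto_snd
        have h3 := (h1.sub h2).norm
        rw [sub_self] at h3
        exact h3.eventually (ge_mem_nhds (by simpa using half_pos hε))
      · have h1 := hW.eventually_norm_orbit_le f t₀ (show 0 < ε / 4 by positivity)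
        have h2 : ∀ᶠ s in cocompact ℝ, ‖W s (s - t₀) (f (s - t₀))‖ ≤ ε / 4 :=
          (hW.tendsto_shift ht₀ f).norm.eventually
            (ge_mem_nhds (show ‖(0 : X)‖ < ε / 4 by simpa using hε))
        filter_upwards [h1, h2.prod_inr (𝓝[Ici 0] t₀)] with z h3 h4
        exact (norm_sub_le _ _).trans (by linarith)
    filter_upwards [key, self_mem_nhdsWithin] with t h1 h2
    rw [dist_eq_norm]
    refine lt_of_le_of_lt (c0_norm_le (half_pos hε).le fun s => ?_) (half_lt_self hε)
    rw [ZeroAtInftyContinuousMap.sub_apply, evolutionSemigroup_apply hW h2,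
      evolutionSemigroup_apply hW ht₀]
    exact h1 s
  isGenerator := hG

theorem IsEvolutionFamily.exists_norm_evolutionSemigroup_le (hW : IsEvolutionFamily W) (a : ℝ) :
    ∃ C, ∀ t ∈ Icc 0 a, ‖evolutionSemigroup W hW t‖ ≤ C := by
  obtain ⟨C, hC0, hC⟩ := hW.exists_norm_le a
  refine ⟨C, fun t ht => ContinuousLinearMap.opNorm_le_bound _ hC0 fun f => ?_⟩
  refine c0_norm_le (by positivity) fun s => ?_
  rw [evolutionSemigroup_apply hW ht.1]
  refine (ContinuousLinearMap.le_opNorm _ _).trans ?_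
  gcongr
  · exact hC t ht s
  · exact c0_norm_apply_le f _

end EvolutionSemigroup

/-! ### The domain of the sum operator. -/

section SumOperator

variable {𝕜 X : Type*} [RCLike 𝕜] [NormedAddCommGroup X] [NormedSpace 𝕜 X] [NormedSpace ℝ X]

theorem exists_of_mem_graph_sumOp {A B : ℝ → X →ₗ.[𝕜] X} {p : C₀(ℝ, X) × C₀(ℝ, X)}
    (hp : p ∈ (sumOp A B).graph) : ∃ d a b : C₀(ℝ, X),
      (∀ s, HasDerivAt (fun r => p.1 r) (d s) s) ∧ (∀ s, (p.1 s, a s) ∈ (A s).graph) ∧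
      (∀ s, (p.1 s, b s) ∈ (B s).graph) ∧ p.2 = -d + a + b := by
  obtain ⟨f, g⟩ := p
  obtain ⟨⟨x, hx⟩, rfl, rfl⟩ := (LinearPMap.mem_graph_iff _).1 hp
  have hd : x ∈ (derivativeOp 𝕜 X).domain := hx.1.1
  have ha : x ∈ (multiplicationOp A).domain := hx.1.2
  have hb : x ∈ (multiplicationOp B).domain := hx.2
  exact ⟨derivativeOp 𝕜 X ⟨x, hd⟩, multiplicationOp A ⟨x, ha⟩, multiplicationOp B ⟨x, hb⟩,
    (mem_graph_derivativeOp _ _).1 (LinearPMap.mem_graph _ ⟨x, hd⟩),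
    (mem_graph_multiplicationOp _ _ _).1 (LinearPMap.mem_graph _ ⟨x, ha⟩),
    (mem_graph_multiplicationOp _ _ _).1 (LinearPMap.mem_graph _ ⟨x, hb⟩), rfl⟩

end SumOperator

/-! ### Reordering of time-ordered products. -/

section OrderedProducts

theorem ascProd_succ_right {R : Type*} [Monoid R] (U : ℕ → R) (n : ℕ) :
    ascProd U (n + 1) = ascProd (fun p => U (p + 1)) n * U 0 := by
  induction n with
  | zero => simp [ascProd]
  | succ n ih => rw [ascProd, ih, ascProd, mul_assoc]

theorem ascProd_congr {R : Type*} [Monoid R] {U V : ℕ → R} {n : ℕ} (h : ∀ p < n, U p = V p) :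
    ascProd U n = ascProd V n := by
  induction n with
  | zero => rfl
  | succ n ih => rw [ascProd, ascProd, h n (by omega), ih fun p hp => h p (by omega)]

theorem descProd_eq_ascProd {R : Type*} [Monoid R] (U : ℕ → R) (n : ℕ) :
    descProd U n = ascProd (fun p => U (n - p)) n := by
  induction n with
  | zero => rfl
  | succ n ih =>
    rw [descProd, ih, ascProd_succ_right]
    simp

theorem ascProd_one {R : Type*} [Monoid R] (n : ℕ) : ascProd (fun _ => (1 : R)) n = 1 := by
  induction n with
  | zero => rfl
  | succ n ih => rw [ascProd, ih, mul_one]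

end OrderedProducts

/-! ### Weighted shifts on bounded functions. -/

section BoundedFunctions

variable {𝕜 X : Type*} [RCLike 𝕜] [NormedAddCommGroup X] [NormedSpace 𝕜 X]

/-- The inclusion of `C₀(ℝ, X)` into the space of all bounded functions. -/
noncomputable def c0ToBounded (𝕜 X : Type*) [RCLike 𝕜] [NormedAddCommGroup X] [NormedSpace 𝕜 X] :
    C₀(ℝ, X) →L[𝕜] lp (fun _ : ℝ => X) ⊤ :=
  LinearMap.mkContinuous
    { toFun := fun f => ⟨fun s => f s, memℓp_infty ⟨‖f‖, by
        rintro _ ⟨s, rfl⟩; exact c0_norm_apply_le f s⟩⟩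
      map_add' := fun _ _ => rfl
      map_smul' := fun _ _ => rfl } 1 fun f => by
    rw [one_mul]
    exact lp.norm_le_of_forall_le (norm_nonneg f) (c0_norm_apply_le f)

theorem c0ToBounded_apply (f : C₀(ℝ, X)) (s : ℝ) : c0ToBounded 𝕜 X f s = f s := rfl

/-- A uniform bound on `U` suffices; no continuity in `r` enters, since the image only has to be
bounded. -/
theorem exists_weightedShift (U : ℝ → X →L[𝕜] X) {C : ℝ} (hU : ∀ r, ‖U r‖ ≤ C) (h : ℝ) :
    ∃ F : lp (fun _ : ℝ => X) ⊤ →L[𝕜] lp (fun _ : ℝ => X) ⊤,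
      ∀ f s, F f s = U (s - h) (f (s - h)) := by
  have hC : 0 ≤ C := (norm_nonneg _).trans (hU 0)
  have hb (f : lp (fun _ : ℝ => X) ⊤) (s : ℝ) : ‖U (s - h) (f (s - h))‖ ≤ C * ‖f‖ := by
    refine (ContinuousLinearMap.le_opNorm _ _).trans ?_
    gcongr
    · exact hU _
    · exact lp.norm_apply_le_norm (by simp) f _
  refine ⟨LinearMap.mkContinuous
    { toFun := fun f => ⟨fun s => U (s - h) (f (s - h)), memℓp_infty ⟨C * ‖f‖, by
        rintro _ ⟨s, rfl⟩; exact hb f s⟩⟩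
      map_add' := fun f g => ?_
      map_smul' := fun c f => ?_ } C fun f => ?_, fun f s => rfl⟩
  · ext s; exact (U _).map_add _ _
  · ext s; exact (U _).map_smul _ _
  · exact lp.norm_le_of_forall_le (by positivity) (hb f)

theorem weightedShift_pow_apply {U : ℝ → X →L[𝕜] X} {h : ℝ}
    {F : lp (fun _ : ℝ => X) ⊤ →L[𝕜] lp (fun _ : ℝ => X) ⊤}
    (hF : ∀ f s, F f s = U (s - h) (f (s - h))) (n : ℕ) (f : lp (fun _ : ℝ => X) ⊤) (s : ℝ) :
    (F ^ n) f s = descProd (fun p => U (s - p * h)) n (f (s - n * h)) := by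
  induction n generalizing f with
  | zero => simp [descProd]
  | succ n ih =>
    rw [pow_succ, mul_apply_eq_comp, ih, hF, descProd, mul_apply_eq_comp]
    push_cast
    rw [show s - n * h - h = s - (n + 1) * h by ring]

end BoundedFunctions

end NonautonomousSplitting

/-! ### Convergence of the splitting. -/

open NonautonomousSplitting in
theorem mainTheorem1 {𝕜 X : Type*} [RCLike 𝕜] [NormedAddCommGroup X] [NormedSpace 𝕜 X]
    [NormedSpace ℝ X] [CompleteSpace X]
    (A B : ℝ → X →ₗ.[𝕜] X) (expA expB : ℝ → ℝ → X →L[𝕜] X) (M ω : ℝ) (hM : 1 ≤ M)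
    (hwp : WellPosed (fun r => A r + B r))
    (hA : ∀ r, GeneratesC0Semigroup (A r) (expA r)) (hAtype : ∀ r, IsOfType (expA r) M ω)
    (hB : ∀ r, GeneratesC0Semigroup (B r) (expB r)) (hBtype : ∀ r, IsOfType (expB r) M ω)
    (hstab : ∀ (t : ℝ) (n : ℕ) (s : ℝ), 0 ≤ t → 1 ≤ n →
      ‖descProd (fun p => expB (s - p * t / n) (t / n) * expA (s - p * t / n) (t / n)) n‖ ≤
        M * Real.exp (ω * t))
    (hAcont : ∀ (μ : ℝ) (x : X), ω < μ → Continuous fun r => resolventOp (A r) (μ : 𝕜) x)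
    (hBcont : ∀ (μ : ℝ) (x : X), ω < μ → Continuous fun r => resolventOp (B r) (μ : 𝕜) x)
    (W : ℝ → ℝ → X →L[𝕜] X) (hW : IsEvolutionFamily W) (hWsol : Solves W (fun r => A r + B r))
    (hclosable : (sumOp A B).IsClosable)
    (hgen : IsGenerator (sumOp A B).closure (evolutionSemigroup W hW))
    (x : X) :
    TendstoLocallyUniformlyOn
      (fun (n : ℕ) (q : ℝ × ℝ) =>
        ascProd (fun p =>
          expB (q.2 + p * (q.1 - q.2) / n) ((q.1 - q.2) / n) *
            expA (q.2 + p * (q.1 - q.2) / n) ((q.1 - q.2) / n)) n x)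
      (fun q : ℝ × ℝ => W q.1 q.2 x) atTop {q : ℝ × ℝ | q.2 ≤ q.1} := by
  have hM0 : 0 ≤ M := zero_le_one.trans hM
  have hF : ∀ h : ℝ, ∃ F : lp (fun _ : ℝ => X) ⊤ →L[𝕜] lp (fun _ : ℝ => X) ⊤,
      0 ≤ h → ∀ f s, F f s = (expB (s - h) h * expA (s - h) h) (f (s - h)) := by
    intro h
    by_cases hh : 0 ≤ h
    · obtain ⟨F, hF⟩ := exists_weightedShift (fun r => expB r h * expA r h)
        (C := M * Real.exp (ω * h) * (M * Real.exp (ω * h)))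
        (fun r => (norm_mul_le _ _).trans (by gcongr; exacts [hBtype r h hh, hAtype r h hh])) h
      exact ⟨F, fun _ => hF⟩
    · exact ⟨0, fun h' => absurd h' hh⟩
  choose F hF using hF
  have hFpow {h : ℝ} (hh : 0 ≤ h) := weightedShift_pow_apply
    (U := fun r => expB r h * expA r h) (hF h hh)
  have hFn : ∀ h, 0 ≤ h → ∀ n : ℕ, ‖F h ^ n‖ ≤ M * Real.exp (ω * (n * h)) := by
    intro h hh n
    refine ContinuousLinearMap.opNorm_le_bound _ (by positivity) fun f => ?_
    refine lp.norm_le_of_forall_le (by positivity) fun s => ?_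
    -- The stability bound covers only `n ≥ 1`; for `n = 0` the bound is `1 ≤ M`.
    rcases Nat.eq_zero_or_pos n with rfl | hn
    · simpa using (lp.norm_apply_le_norm (by simp) f s).trans
        (le_mul_of_one_le_left (norm_nonneg _) hM)
    · rw [hFpow hh]
      refine (ContinuousLinearMap.le_opNorm _ _).trans ?_
      gcongr
      · have hn' : (n : ℝ) ≠ 0 := by positivity
        have := hstab (n * h) n s (by positivity) hn
        have e (p : ℕ) : (p : ℝ) * (n * h) / n = p * h := by field_simp
        simpa only [e, mul_div_cancel_left₀ h hn'] using this
      · exact lp.norm_apply_le_norm (by simp) f _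
  have hcons : ∀ p ∈ ((sumOp A B).graph : Set (C₀(ℝ, X) × C₀(ℝ, X))),
      Tendsto (fun h : ℝ => h⁻¹ • (F h (c0ToBounded 𝕜 X p.1) - c0ToBounded 𝕜 X p.1)) (𝓝[>] 0)
        (𝓝 (c0ToBounded 𝕜 X p.2)) := by
    intro p hp
    obtain ⟨d, a, b, hd, ha, hb, hp2⟩ := exists_of_mem_graph_sumOp hp
    rw [Metric.tendsto_nhds]
    intro ε hε
    have key := eventually_forall_splitting_sub_le hM0 hA hAtype hB hBtype (lt_add_one ω)
      (fun x => hAcont _ x (lt_add_one ω)) (fun x => hBcont _ x (lt_add_one ω)) hd ha hb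
      (half_pos hε)
    filter_upwards [nhdsWithin_mono 0 Ioi_subset_Ici_self key, self_mem_nhdsWithin]
      with h h1 (h2 : 0 < h)
    rw [dist_eq_norm]
    refine lt_of_le_of_lt (lp.norm_le_of_forall_le (half_pos hε).le fun s => ?_) (half_lt_self hε)
    have e : (h⁻¹ • (F h (c0ToBounded 𝕜 X p.1) - c0ToBounded 𝕜 X p.1) - c0ToBounded 𝕜 X p.2 :
        lp (fun _ : ℝ => X) ⊤) s = h⁻¹ • (expB (s - h) h (expA (s - h) h (p.1 (s - h))) - p.1 s
          - h • (-d s + a s + b s)) := by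
      rw [smul_sub _ _ (h • _), inv_smul_smul₀ h2.ne', lp.coeFn_sub, Pi.sub_apply, lp.coeFn_smul,
        Pi.smul_apply, lp.coeFn_sub, Pi.sub_apply, hF h h2.le, c0ToBounded_apply,
        c0ToBounded_apply, c0ToBounded_apply, hp2]
      rfl
    rw [e, norm_smul, norm_inv, Real.norm_of_nonneg h2.le, inv_mul_le_iff₀ h2, mul_comm]
    exact h1 s
  have hgraph : ((sumOp A B).closure.graph : Set (C₀(ℝ, X) × C₀(ℝ, X))) ⊆
      closure ((sumOp A B).graph : Set (C₀(ℝ, X) × C₀(ℝ, X))) := by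
    rw [← hclosable.graph_closure_eq_closure_graph, Submodule.topologicalClosure_coe]
  have hcher := chernoff (hW.generatesC0Semigroup hgen) hW.exists_norm_evolutionSemigroup_le hgraph
    hM0 hFn hcons
  rw [Metric.tendstoLocallyUniformlyOn_iff]
  intro ε hε q₀ _
  -- A compactly supported cut-off equal to one within distance one of the initial time `q₀.2`, so
  -- that a single `f = φ x` in `C₀` serves every initial time in the neighbourhood.
  obtain ⟨φ, hφ1, -, hφc, -⟩ := exists_continuous_one_zero_of_isCompact
    (isCompact_closedBall q₀.2 1) isClosed_empty (disjoint_empty _)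
  obtain ⟨f, hf⟩ : ∃ f : C₀(ℝ, X), ∀ s, f s = φ s • x :=
    ⟨{ toFun := fun s => φ s • x
       continuous_toFun := by fun_prop
       zero_at_infty' := by
        simpa using hφc.is_zero_at_infty.smul_const x }, fun s => rfl⟩
  -- Bounds `t - s` for all `(t, s)` within distance one of `q₀`.
  set a : ℝ := q₀.1 - q₀.2 + 2 with ha
  obtain ⟨δ, hδ0, hδ⟩ := mem_nhdsGT_iff_exists_Ioo_subset.1 (hcher f a (half_pos hε))
  refine ⟨Metric.ball q₀ 1 ∩ {q | q.2 ≤ q.1}, inter_mem (mem_nhdsWithin_of_mem_nhds (Metric.ball_mem_nhds _ one_pos))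
    self_mem_nhdsWithin, ?_⟩
  obtain ⟨n₀, hn₀⟩ := exists_nat_gt (a / δ)
  filter_upwards [eventually_ge_atTop (max n₀ 1)] with n hn
  rintro ⟨t, s⟩ ⟨hq, hst⟩
  have hn1 : 1 ≤ n := (le_max_right _ _).trans hn
  have hnpos : (0 : ℝ) < n := by positivity
  -- On the diagonal the step size is zero, which Chernoff's formula excludes; there both sides are
  -- `x`.
  rcases (show s ≤ t from hst).eq_or_lt with rfl | hlt
  · simpa [(hA _).map_zero, (hB _).map_zero, ascProd_one, hW.refl] using hε
  rw [Metric.mem_ball, Prod.dist_eq, max_lt_iff] at hq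
  have hta : t - s ≤ a := by
    have h1 := (abs_lt.1 hq.1).2
    have h2 := (abs_lt.1 hq.2).1
    simp only at h1 h2
    linarith
  set h : ℝ := (t - s) / n with hh
  have hnh : n * h = t - s := mul_div_cancel₀ _ hnpos.ne'
  have hh0 : 0 < h := div_pos (sub_pos.2 hlt) hnpos
  have hhδ : h < δ := by
    have : a / δ < n := hn₀.trans_le (by exact_mod_cast (le_max_left _ _).trans hn)
    rw [div_lt_iff₀ hδ0] at this
    rw [hh, div_lt_iff₀ hnpos]
    linarith
  have hfs : f s = x := by
    rw [hf, hφ1 hq.2.le, Pi.one_apply, one_smul]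
  -- The sup-norm estimate is evaluated at the final time `t`: after `n` steps the argument of `f`
  -- is `t - n h = s`, where `f` equals `x`.
  have key := (lp.norm_apply_le_norm (by simp) _ t).trans
    (hδ ⟨hh0, hhδ⟩ n (hnh.le.trans hta))
  rw [lp.coeFn_sub, Pi.sub_apply, hFpow hh0.le, c0ToBounded_apply, c0ToBounded_apply,
    evolutionSemigroup_apply hW (by rw [hnh]; linarith), hnh, sub_sub_cancel, hfs,
    descProd_eq_ascProd] at key
  rw [dist_comm, dist_eq_norm]
  refine lt_of_le_of_lt (le_of_eq_of_le ?_ key) (half_lt_self hε)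
  congr 3
  -- Counted backwards from `t`, the factor with index `n - p` sits at `t - (n - p) h = s + p h`.
  refine ascProd_congr fun p hp => ?_
  have e : s + p * (t - s) / n = t - ((n - p : ℕ) : ℝ) * h := by
    rw [Nat.cast_sub hp.le, sub_mul, hnh, hh]
    ring
  simp only [e]
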